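/- Let $C$ be the circle of circumference $1$ with the arclength metric, and let $(\ell_n)_{n\ge1}$ be a (weakly) decreasing sequence of positive numbers with $\ell_1\le 1/2$ and $\ell_n=\Theta(1/n)$, i.e. there are constants $0<M_0\le M_1<\infty$ such that $M_0/n\le \ell_n\le M_1/n$ for all $n\ge 1$. Put $u_n:=\prod_{k=1}^n(1-\ell_k)$. On a probability space let $\{C_{i,j}\}_{i,j\ge1}$, $\{Y_{i,j}\}_{i,j\ge1}$ be independent random variables (the whole collection being independent), where each $C_{i,j}$ is uniformly distributed on $C$ and each $Y_{i,j}$ is exponentially distributed with parameter $1$. Let $T_{i,j}:=\sum_{k=1}^{j}Y_{i,k}$ (so $T_{i,0}=0$), and for $t\ge0$ let $U_{i,t}:=C_{i,j}$ when $T_{i,j-1}\le t<T_{i,j}$; thus the center of the $i$-th arc is replaced by a fresh uniform point at the times of a rate-$1$ Poisson process (the Poisson model with parameter $\alpha=0$). Let $I_{n,t}$ be the open arc of $C$ with center $U_{n,t}$ and length $\ell_n$, and let $F_t:=C\setminus\limsup_n I_{n,t}$ be the set of points that lie in only finitely many of the arcs $I_{n,t}$, $n\ge1$. (i) If $\liminf_{n\to\infty}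 n(\log n)\,u_n<\infty$, then $P(\exists\, t\in[0,1]: F_t\ne\emptyset)=0$. (ii) If $\displaystyle\sum_{n=2}^{\infty}\frac{e^{\ell_1+\ell_2+\cdots+\ell_n}}{n^2\log n}<\infty$, then $P(\exists\, t\in[0,1]: F_t\ne\emptyset)=1$. -/

import Mathlib

open MeasureTheory ProbabilityTheory Filter

noncomputable section

namespace CircleCovering

/-- The circle of circumference `1`, with its group structure, the arclength distance
`dist x y = ‖x - y‖ ∈ [0, 1/2]` and the arclength (uniform probability) measure `volume`. -/
abbrev Circ : Type := AddCircle (1 : ℝ)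

/-- The open arc of the circle with center `c` and length `len`. -/
def arc (c : Circ) (len : ℝ) : Set Circ := {x | ‖x - c‖ < len / 2}

/-- `ℓ_n = Θ(1/n)`. Sequences are indexed from `0`: the entry `ℓ n` is the length of
the `(n + 1)`-st arc, usually written `ℓ_{n+1}`. -/
def IsThetaInv (ℓ : ℕ → ℝ) : Prop :=
  ∃ M₀ M₁ : ℝ, 0 < M₀ ∧ M₀ ≤ M₁ ∧
    ∀ n : ℕ, M₀ / ((n : ℝ) + 1) ≤ ℓ n ∧ ℓ n ≤ M₁ / ((n : ℝ) + 1)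

/-- `u_n = (1 - ℓ_1) ⋯ (1 - ℓ_n)`, the product of the first `n` factors. -/
def u (ℓ : ℕ → ℝ) (n : ℕ) : ℝ := ∏ k ∈ Finset.range n, (1 - ℓ k)

/-- `ℓ_1 + ⋯ + ℓ_n`, the total length of the first `n` arcs. -/
def partialLength (ℓ : ℕ → ℝ) (n : ℕ) : ℝ := ∑ k ∈ Finset.range n, ℓ k

/-- The random input of the Poisson model with parameter `α`: all the variables `C i j`, `Y i j`
together are independent, `C i j` (the `j`-th center of the `i`-th arc) is uniform on the circle,
and `Y i j` (the `j`-th waiting time of the `i`-th arc) is exponential with parameter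
`(ℓ i) ^ (-α)`. -/
structure IsPoissonInput {Ω : Type*} [MeasurableSpace Ω] (P : Measure Ω) (α : ℝ) (ℓ : ℕ → ℝ)
    (C : ℕ → ℕ → Ω → Circ) (Y : ℕ → ℕ → Ω → ℝ) : Prop where
  measurable_center : ∀ i j, Measurable (C i j)
  measurable_wait : ∀ i j, Measurable (Y i j)
  law_center : ∀ i j, P.map (C i j) = volume
  law_wait : ∀ i j, P.map (Y i j) = expMeasure ((ℓ i) ^ (-α))
  indep : iIndep
    (Sum.elim
      (fun p : ℕ × ℕ => MeasurableSpace.comap (C p.1 p.2) inferInstance)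
      (fun p : ℕ × ℕ => MeasurableSpace.comap (Y p.1 p.2) inferInstance)) P

variable {Ω : Type*}

/-- The time of the `j`-th update of the `i`-th arc (and time `0` for `j = 0`). -/
def updateTime (Y : ℕ → ℕ → Ω → ℝ) (i j : ℕ) (ω : Ω) : ℝ := ∑ k ∈ Finset.range j, Y i k ω

/-- The center of the `i`-th arc at time `t`: it equals `C i j` on the time interval from the
`j`-th update (included) to the next one (excluded). -/
def center (C : ℕ → ℕ → Ω → Circ) (Y : ℕ → ℕ → Ω → ℝ) (i : ℕ) (t : ℝ) (ω : Ω) : Circ :=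
  ∑' j : ℕ, Set.indicator (Set.Ico (updateTime Y i j ω) (updateTime Y i (j + 1) ω))
    (fun _ => C i j ω) t

/-- `E_t`: the points of the circle that belong to infinitely many arcs at time `t`. -/
def coveredSet (ℓ : ℕ → ℝ) (C : ℕ → ℕ → Ω → Circ) (Y : ℕ → ℕ → Ω → ℝ) (t : ℝ) (ω : Ω) :
    Set Circ :=
  limsup (fun n => arc (center C Y n t ω) (ℓ n)) atTop

/-- `F_t`: the complement of `E_t`, the points that belong to only finitely many arcs
at time `t`. -/
def uncoveredSet (ℓ : ℕ → ℝ) (C : ℕ → ℕ → Ω → Circ) (Y : ℕ → ℕ → Ω → ℝ) (t : ℝ) (ω : Ω) :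
    Set Circ :=
  (coveredSet ℓ C Y t ω)ᶜ

end CircleCovering

end

noncomputable section

namespace CircleCovering

/-! ### The exponential distribution and i.i.d. exponential waiting times -/

/-! Part (i) is a first moment bound followed by a killing argument. A fixed point is missed by the
first `n` arcs at a given time with probability `u_n`. It becomes missed afresh at rate at most
`u_n` times the total length, so it is missed at some time in `[0, 1]` with probability of order
`u_n log n` (`measureReal_missedSometime_le`). On a grid of order `n` points the expected number of
such bad points is `O(n log n u_n)`, which is bounded along a subsequence. With high probability
there are therefore at most `K` bad points, with `K` a constant. Given them, the independent arcs
with index in `[n, 2n)` cover all of them, without any update during `[0, 1]`, with probability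
bounded below. The probability of being exposed thus drops by a fixed fraction between `n` and `2n`
(`measureReal_exposed_step`). Being monotone in `n`, it cannot have a positive limit
(`tendsto_measureReal_exposed`).

Part (ii) is the second moment method for the area of the uncovered subset of `[0, 1] × C`. For
points at distance `s` and times at distance `τ`, the normalized correlation is at most `exp(e^{-τ}
S + O(1))`, where `S` sums the `ℓ_i` with `i < M/s`. Integrating over `τ` gains a factor `1/S`,
which is `O(1/log(M/s))`. Integrating over `s` by levels of `M/s` then gives the series of the
hypothesis (`lintegral_correlation_zero_ne_top`). If the arcs before `m` are dropped, dominated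
convergence sends the correlation integral to `1`, so almost surely some tail of the sequence leaves
positive area uncovered at every finite stage. Compactness yields a limit point
(`exists_limit_uncovered`). Only an arc that updates exactly at the limit time can spoil it, and
almost surely there is at most one, which is harmless for a limsup set. -/

instance isProbabilityMeasure_expMeasure_one : IsProbabilityMeasure (expMeasure 1) :=
  isProbabilityMeasure_expMeasure one_pos

lemma expMeasure_Iic {s : ℝ} (hs : 0 ≤ s) :
    expMeasure 1 (Set.Iic s) = ENNReal.ofReal (1 - Real.exp (-s)) := by
  rw [← ofReal_cdf, cdf_expMeasure_eq one_pos, if_pos hs, one_mul]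

lemma expMeasure_Ioi {s : ℝ} (hs : 0 ≤ s) :
    expMeasure 1 (Set.Ioi s) = ENNReal.ofReal (Real.exp (-s)) := by
  rw [← Set.compl_Iic, prob_compl_eq_one_sub measurableSet_Iic, expMeasure_Iic hs,
    ← ENNReal.ofReal_one, ← ENNReal.ofReal_sub _ (by simpa using hs)]
  congr 1
  ring

lemma expMeasure_singleton (s : ℝ) : expMeasure 1 {s} = 0 := by
  rw [expMeasure, gammaMeasure]
  exact (withDensity_absolutelyContinuous _ _) (by simp)

/-- The law of a sequence of independent exponential waiting times of parameter `1`. -/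
abbrev waitLaw : Measure (ℕ → ℝ) := Measure.infinitePi fun _ => expMeasure 1

/-- The `j`-th update time for the waiting times `y`. -/
def arrival (y : ℕ → ℝ) (j : ℕ) : ℝ := ∑ k ∈ Finset.range j, y k

@[simp] lemma arrival_zero (y : ℕ → ℝ) : arrival y 0 = 0 := by simp [arrival]

lemma arrival_succ (y : ℕ → ℝ) (j : ℕ) : arrival y (j + 1) = arrival y j + y j :=
  Finset.sum_range_succ _ _

lemma measurable_arrival (j : ℕ) : Measurable fun y : ℕ → ℝ => arrival y j := by
  unfold arrival
  fun_prop

/-- The waiting times are positive and the update times tend to infinity. -/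
def Regular (y : ℕ → ℝ) : Prop := (∀ j, 0 < y j) ∧ Tendsto (arrival y) atTop atTop

lemma Regular.strictMono {y : ℕ → ℝ} (hy : Regular y) : StrictMono (arrival y) :=
  strictMono_nat_of_lt_succ fun j => by rw [arrival_succ]; linarith [hy.1 j]

lemma ae_forall_pos_waitLaw : ∀ᵐ y ∂waitLaw, ∀ j, 0 < y j := by
  rw [ae_all_iff]
  intro j
  have h : ∀ᵐ s ∂(expMeasure 1), 0 < s := by
    rw [ae_iff]
    have : {a : ℝ | ¬ 0 < a} = Set.Iic 0 := by ext; simp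
    rw [this, expMeasure_Iic le_rfl]
    simp
  exact (measurePreserving_eval_infinitePi (fun _ : ℕ => expMeasure 1) j).quasiMeasurePreserving.ae h

/-- The first `n` waits all stay below `M` with probability `(1 - e^{-M})^n`, so the waits are
almost surely unbounded. A single wait longer than `M` already pushes the update times beyond `M`.
-/
lemma ae_regular_waitLaw : ∀ᵐ y ∂waitLaw, Regular y := by
  have hub : ∀ᵐ y ∂waitLaw, ∀ M : ℕ, ∃ j, (M : ℝ) < y j := by
    rw [ae_all_iff]
    intro M
    rw [ae_iff]
    have hlt : expMeasure 1 (Set.Iic (M : ℝ)) < 1 := by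
      rw [expMeasure_Iic M.cast_nonneg, ENNReal.ofReal_lt_one]
      linarith [Real.exp_pos (-(M : ℝ))]
    have hle : ∀ n : ℕ, waitLaw {y | ¬ ∃ j, (M : ℝ) < y j} ≤ (expMeasure 1 (Set.Iic (M : ℝ))) ^ n := by
      intro n
      calc waitLaw {y | ¬ ∃ j, (M : ℝ) < y j}
          ≤ waitLaw ((Finset.range n : Set ℕ).pi fun _ => Set.Iic (M : ℝ)) := by
            refine measure_mono fun y hy => ?_
            simp only [Set.mem_ofPred_eq, not_exists, not_lt] at hy
            exact fun j _ => hy j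
        _ = _ := by
            rw [Measure.infinitePi_pi _ fun _ _ => measurableSet_Iic]
            simp
    have hlim := ENNReal.tendsto_pow_atTop_nhds_zero_of_lt_one hlt
    exact le_antisymm (ge_of_tendsto' hlim hle) bot_le
  filter_upwards [ae_forall_pos_waitLaw, hub] with y hpos hub
  have hmono : Monotone (arrival y) :=
    monotone_nat_of_le_succ fun j => by rw [arrival_succ]; linarith [hpos j]
  refine ⟨hpos, tendsto_atTop_atTop_of_monotone hmono fun b => ?_⟩
  obtain ⟨M, hM⟩ := exists_nat_ge b
  obtain ⟨j, hj⟩ := hub M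
  refine ⟨j + 1, ?_⟩
  have h0 : 0 ≤ arrival y j := by simpa using hmono (Nat.zero_le j)
  rw [arrival_succ]
  linarith

/-- The number of updates up to time `t` (for regular waiting times). -/
def updateCount (t : ℝ) (y : ℕ → ℝ) : ℕ := sInf {j | t < arrival y (j + 1)}

lemma Regular.lt_arrival {y : ℕ → ℝ} (hy : Regular y) (t : ℝ) :
    t < arrival y (updateCount t y + 1) := by
  have : {j | t < arrival y (j + 1)}.Nonempty := by
    obtain ⟨j, hj⟩ := (((tendsto_add_atTop_iff_nat 1).2 hy.2).eventually_gt_atTop t).exists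
    exact ⟨j, hj⟩
  exact Nat.sInf_mem this

lemma arrival_updateCount_le {t : ℝ} (ht : 0 ≤ t) (y : ℕ → ℝ) :
    arrival y (updateCount t y) ≤ t := by
  rcases h : updateCount t y with _ | k
  · simpa using ht
  · have : k ∉ {j | t < arrival y (j + 1)} := Nat.notMem_of_lt_sInf (by
      change k < updateCount t y
      omega)
    simpa using this

lemma Regular.updateCount_eq_iff {y : ℕ → ℝ} (hy : Regular y) {t : ℝ} (ht : 0 ≤ t) (j : ℕ) :
    updateCount t y = j ↔ arrival y j ≤ t ∧ t < arrival y (j + 1) := by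
  have h1 := hy.lt_arrival t
  have h2 := arrival_updateCount_le ht y
  constructor
  · rintro rfl
    exact ⟨h2, h1⟩
  · rintro ⟨h3, h4⟩
    have h5 := hy.strictMono.lt_iff_lt.1 (h2.trans_lt h4)
    have h6 := hy.strictMono.lt_iff_lt.1 (h3.trans_lt h1)
    omega

lemma Regular.exists_updateCount_eq_right {y : ℕ → ℝ} (hy : Regular y) {t : ℝ} (ht : 0 ≤ t) :
    ∃ ε > 0, ∀ s ∈ Set.Ico t (t + ε), updateCount s y = updateCount t y := by
  have h1 := hy.lt_arrival t
  have h2 := arrival_updateCount_le ht y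
  refine ⟨arrival y (updateCount t y + 1) - t, sub_pos.2 h1, fun s hs => ?_⟩
  rw [hy.updateCount_eq_iff (ht.trans hs.1)]
  exact ⟨h2.trans hs.1, by linarith [hs.2]⟩

/-- Two-sided continuity away from the update times. The index `j = 0` is excluded because time `0`
is not an update; the restriction to `[0, ∞)` takes care of `t = 0`. -/
lemma Regular.eventually_updateCount_eq {y : ℕ → ℝ} (hy : Regular y) {t : ℝ} (ht : 0 ≤ t)
    (h : ∀ j, 1 ≤ j → arrival y j ≠ t) :
    ∀ᶠ s in nhdsWithin t (Set.Ici 0), updateCount s y = updateCount t y := by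
  have h1 := hy.lt_arrival t
  have h2 := arrival_updateCount_le ht y
  have hright : ∀ᶠ s in nhds t, s < arrival y (updateCount t y + 1) := eventually_lt_nhds h1
  rcases Nat.eq_zero_or_pos (updateCount t y) with h0 | h0
  · filter_upwards [nhdsWithin_le_nhds hright, self_mem_nhdsWithin] with s hs hs0
    rw [hy.updateCount_eq_iff hs0]
    exact ⟨by rw [h0]; simpa using hs0, hs⟩
  · have hleft : ∀ᶠ s in nhds t, arrival y (updateCount t y) < s :=
      eventually_gt_nhds (lt_of_le_of_ne h2 (h _ h0))
    filter_upwards [nhdsWithin_le_nhds hright, nhdsWithin_le_nhds hleft, self_mem_nhdsWithin]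
      with s hs hs' hs0
    rw [hy.updateCount_eq_iff hs0]
    exact ⟨hs'.le, hs⟩

lemma measurable_updateCount : Measurable fun p : ℝ × (ℕ → ℝ) => updateCount p.1 p.2 := by
  have hA : ∀ j, MeasurableSet {p : ℝ × (ℕ → ℝ) | p.1 < arrival p.2 (j + 1)} := fun j =>
    measurableSet_lt measurable_fst ((measurable_arrival _).comp measurable_snd)
  refine measurable_to_countable' fun j => ?_
  rcases j with _ | j
  -- The value `0` also arises as `sInf ∅`, when no update time exceeds `p.1`.
  · have : (fun p : ℝ × (ℕ → ℝ) => updateCount p.1 p.2) ⁻¹' {0} =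
        {p | p.1 < arrival p.2 (0 + 1)} ∪ ⋂ i, {p | p.1 < arrival p.2 (i + 1)}ᶜ := by
      ext p
      simp only [updateCount, Set.mem_preimage, Set.mem_singleton_iff, Nat.sInf_eq_zero,
        Set.mem_union, Set.mem_iInter, Set.eq_empty_iff_forall_notMem]
      rfl
    rw [this]
    exact (hA 0).union (MeasurableSet.iInter fun i => (hA i).compl)
  · have : (fun p : ℝ × (ℕ → ℝ) => updateCount p.1 p.2) ⁻¹' {j + 1} =
        {p | p.1 < arrival p.2 (j + 1 + 1)} ∩ ⋂ i ∈ Finset.range (j + 1),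
          {p | p.1 < arrival p.2 (i + 1)}ᶜ := by
      ext p
      simp only [Set.mem_preimage, Set.mem_singleton_iff, Set.mem_inter_iff, Set.mem_iInter,
        Finset.mem_range]
      constructor
      · intro h
        have hne : {i | p.1 < arrival p.2 (i + 1)}.Nonempty := Nat.nonempty_of_sInf_eq_succ h
        refine ⟨?_, fun i hi => ?_⟩
        · have := Nat.sInf_mem hne
          rwa [show sInf {i | p.1 < arrival p.2 (i + 1)} = j + 1 from h] at this
        · exact Nat.notMem_of_lt_sInf (by
            rw [show sInf {i | p.1 < arrival p.2 (i + 1)} = j + 1 from h]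
            exact hi)
      · rintro ⟨h1, h2⟩
        refine le_antisymm (Nat.sInf_le h1) ?_
        by_contra hlt
        exact h2 _ (not_le.1 hlt) (Nat.sInf_mem (s := {i | p.1 < arrival p.2 (i + 1)}) ⟨_, h1⟩)
    rw [this]
    exact (hA _).inter (Finset.measurableSet_biInter _ fun i _ => (hA i).compl)

lemma measurable_updateCount_right (t : ℝ) : Measurable (updateCount t) :=
  measurable_updateCount.comp measurable_prodMk_left

lemma indepFun_arrival_wait (j : ℕ) :
    IndepFun (fun y : ℕ → ℝ => arrival y j) (fun y => y j) waitLaw := by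
  have h : iIndepFun (fun (i : ℕ) (y : ℕ → ℝ) => y i) waitLaw :=
    iIndepFun_infinitePi (X := fun _ => id) fun _ => measurable_id
  have := h.indepFun_finsetSum_of_notMem (fun i => measurable_pi_apply i)
    (s := Finset.range j) (i := j) (by simp)
  convert this using 1
  ext y
  simp [arrival]

/-- Conditionally on the `j`-th update time `a ≤ s`, the next wait is independent of it and has to
exceed `t - a`. -/
lemma waitLaw_no_update_at {s t : ℝ} (hst : s ≤ t) (j : ℕ) :
    waitLaw {y | arrival y j ≤ s ∧ t < arrival y (j + 1)} =
      ∫⁻ a in Set.Iic s, ENNReal.ofReal (Real.exp (-(t - a))) ∂(waitLaw.map fun y => arrival y j) := by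
  have hlaw := (indepFun_iff_map_prod_eq_prod_map_map (measurable_arrival j).aemeasurable
    (measurable_pi_apply j).aemeasurable).1 (indepFun_arrival_wait j)
  rw [Measure.infinitePi_map_eval] at hlaw
  have hmeas : MeasurableSet {p : ℝ × ℝ | p.1 ≤ s ∧ t < p.1 + p.2} :=
    (measurableSet_le measurable_fst measurable_const).inter
      (measurableSet_lt measurable_const (measurable_fst.add measurable_snd))
  have : {y : ℕ → ℝ | arrival y j ≤ s ∧ t < arrival y (j + 1)} =
      (fun y => (arrival y j, y j)) ⁻¹' {p : ℝ × ℝ | p.1 ≤ s ∧ t < p.1 + p.2} := by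
    ext y
    simp [arrival_succ]
  rw [this, ← Measure.map_apply ((measurable_arrival j).prodMk (measurable_pi_apply j)) hmeas, hlaw,
    Measure.prod_apply hmeas, ← lintegral_indicator measurableSet_Iic]
  refine lintegral_congr fun a => ?_
  by_cases ha : a ≤ s
  · rw [Set.indicator_of_mem (by exact ha), ← expMeasure_Ioi (by linarith)]
    congr 1
    ext b
    simp only [Set.mem_preimage, Set.mem_ofPred_eq, Set.mem_Ioi, ha, true_and]
    constructor <;> intro h <;> linarith
  · rw [Set.indicator_of_notMem (by exact ha)]
    have : Prod.mk a ⁻¹' {p : ℝ × ℝ | p.1 ≤ s ∧ t < p.1 + p.2} = ∅ := by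
      ext b
      simp [ha]
    rw [this, measure_empty]

/-- The probability of no update during `(s, t]` is `e^{-(t-s)}`. -/
lemma waitLaw_updateCount_eq {s t : ℝ} (hs : 0 ≤ s) (hst : s ≤ t) :
    waitLaw {y | updateCount s y = updateCount t y} = ENNReal.ofReal (Real.exp (-(t - s))) := by
  have hsum : ∀ {r : ℝ}, s ≤ r → waitLaw {y | updateCount s y = updateCount r y} =
      ∑' j, waitLaw {y | arrival y j ≤ s ∧ r < arrival y (j + 1)} := by
    intro r hr
    have hmeas : ∀ j, MeasurableSet {y : ℕ → ℝ | updateCount s y = j ∧ updateCount r y = j} :=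
      fun j => (measurable_updateCount_right s (measurableSet_singleton j)).inter
        (measurable_updateCount_right r (measurableSet_singleton j))
    have hU : {y | updateCount s y = updateCount r y} =
        ⋃ j, {y : ℕ → ℝ | updateCount s y = j ∧ updateCount r y = j} := by
      ext y
      simp [eq_comm]
    rw [hU, measure_iUnion (fun i j hij => Set.disjoint_left.2 fun y h1 h2 =>
      hij (h1.1.symm.trans h2.1)) hmeas]
    refine tsum_congr fun j => measure_congr ?_
    filter_upwards [ae_regular_waitLaw] with y hy
    refine propext ?_
    change (updateCount s y = j ∧ updateCount r y = j) ↔ (arrival y j ≤ s ∧ r < arrival y (j + 1))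
    rw [hy.updateCount_eq_iff hs, hy.updateCount_eq_iff (hs.trans hr)]
    constructor
    · rintro ⟨h1, h2⟩
      exact ⟨h1.1, h2.2⟩
    · rintro ⟨h1, h2⟩
      exact ⟨⟨h1, by linarith⟩, by linarith, h2⟩
  have hone : ∑' j, waitLaw {y | arrival y j ≤ s ∧ s < arrival y (j + 1)} = 1 := by
    rw [← hsum le_rfl]
    simp
  rw [hsum hst]
  -- Lack of memory: `e^{-(t-a)} = e^{-(t-s)} e^{-(s-a)}`. The remaining probabilities sum to `1`
  -- over `j`.
  have : ∀ j, waitLaw {y | arrival y j ≤ s ∧ t < arrival y (j + 1)} =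
      ENNReal.ofReal (Real.exp (-(t - s))) *
        waitLaw {y | arrival y j ≤ s ∧ s < arrival y (j + 1)} := by
    intro j
    rw [waitLaw_no_update_at hst, waitLaw_no_update_at le_rfl, ← lintegral_const_mul]
    · refine lintegral_congr fun a => ?_
      rw [← ENNReal.ofReal_mul (Real.exp_pos _).le, ← Real.exp_add]
      congr 2
      ring
    · fun_prop
  simp_rw [this]
  rw [ENNReal.tsum_mul_left, hone, mul_one]

/-! ### Arcs of the circle -/

instance isProbabilityMeasure_volume_circ : IsProbabilityMeasure (volume : Measure Circ) :=
  ⟨UnitAddCircle.measure_univ⟩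

/-- The centers of the arcs of length `a` that do not contain `x`. -/
def avoiding (x : Circ) (a : ℝ) : Set Circ := {c | a / 2 ≤ ‖x - c‖}

lemma mem_avoiding {x c : Circ} {a : ℝ} : c ∈ avoiding x a ↔ x ∉ arc c a := by
  simp [avoiding, arc]

lemma avoiding_eq_compl_ball (x : Circ) (a : ℝ) : avoiding x a = (Metric.ball x (a / 2))ᶜ := by
  ext c
  simp [avoiding, dist_eq_norm, norm_sub_rev x c]

lemma measurableSet_avoiding (x : Circ) (a : ℝ) : MeasurableSet (avoiding x a) := by
  rw [avoiding_eq_compl_ball]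
  exact measurableSet_ball.compl

lemma volume_real_ball_circ (x : Circ) {a : ℝ} (h0 : 0 ≤ a) (h1 : a ≤ 1) :
    volume.real (Metric.ball x (a / 2)) = a := by
  rw [Measure.real, ← measure_congr AddCircle.closedBall_ae_eq_ball, AddCircle.volume_closedBall,
    mul_div_cancel₀ a two_ne_zero, min_eq_right h1, ENNReal.toReal_ofReal h0]

lemma volume_real_avoiding (x : Circ) {a : ℝ} (h0 : 0 ≤ a) (h1 : a ≤ 1) :
    volume.real (avoiding x a) = 1 - a := by
  rw [avoiding_eq_compl_ball, measureReal_compl measurableSet_ball, volume_real_ball_circ x h0 h1]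
  simp

lemma exists_real_lift (d : Circ) : ∃ δ : ℝ, (δ : Circ) = d ∧ |δ| = ‖d‖ := by
  induction d using QuotientAddGroup.induction_on with
  | H r =>
    refine ⟨r - round r, ?_, ?_⟩
    · rw [AddCircle.coe_sub, sub_eq_self]
      exact (AddCircle.coe_eq_zero_iff _).2 ⟨round r, by simp⟩
    · exact (UnitAddCircle.norm_eq (x := r)).symm

lemma norm_circ_le_half (d : Circ) : ‖d‖ ≤ 1 / 2 := by
  simpa using AddCircle.norm_le_half_period (p := (1 : ℝ)) (x := d) one_ne_zero

/-- The intersection is centered at the midpoint of `x` and `x'`, as on the line. The bound `a ≤ 1 /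
2` prevents the two arcs from also meeting on the far side of the circle. -/
lemma ball_inter_ball_subset (x x' : Circ) {a : ℝ} (ha : a ≤ 1 / 2) :
    ∃ z : Circ, Metric.ball x (a / 2) ∩ Metric.ball x' (a / 2) ⊆
      Metric.closedBall z ((a - ‖x - x'‖) / 2) := by
  obtain ⟨δ, hδ, hδn⟩ := exists_real_lift (x' - x)
  refine ⟨x + ((δ / 2 : ℝ) : Circ), fun y hy => ?_⟩
  obtain ⟨η, hη, hηn⟩ := exists_real_lift (y - x)
  have h1 : |η| < a / 2 := by
    rw [hηn, ← dist_eq_norm]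
    exact hy.1
  have hδ2 : |δ| ≤ 1 / 2 := hδn ▸ norm_circ_le_half _
  have h2 : |η - δ| < a / 2 := by
    have h3 : ‖((η - δ : ℝ) : Circ)‖ < a / 2 := by
      rw [AddCircle.coe_sub, hη, hδ, sub_sub_sub_cancel_right, ← dist_eq_norm]
      exact hy.2
    rw [UnitAddCircle.norm_eq] at h3
    rw [abs_lt] at h1 h3
    rw [abs_le] at hδ2
    -- The rounding term is less than `1/4 + 1/4 + 1/2` in absolute value, hence zero: the lifts do
    -- not wrap around.
    have h4 : (round (η - δ) : ℝ) < 1 := by linarith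
    have h5 : (-1 : ℝ) < round (η - δ) := by linarith
    have h6 : round (η - δ) = 0 := by
      have h4' : round (η - δ) < 1 := by exact_mod_cast h4
      have h5' : -1 < round (η - δ) := by exact_mod_cast h5
      omega
    rw [h6] at h3
    rw [abs_lt]
    constructor <;> push_cast at h3 <;> linarith
  have h7 : |η - δ / 2| ≤ (a - |δ|) / 2 := by
    rw [abs_lt] at h1 h2
    rw [abs_le]
    rcases abs_cases δ with ⟨h, -⟩ | ⟨h, -⟩ <;> rw [h] <;> constructor <;> linarith
  rw [mem_closedBall_iff_norm, norm_sub_rev x x', ← hδn]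
  have h8 : y - (x + ((δ / 2 : ℝ) : Circ)) = ((η - δ / 2 : ℝ) : Circ) := by
    rw [AddCircle.coe_sub, hη]
    abel
  rw [h8]
  exact (QuotientAddGroup.norm_mk_le_norm).trans h7

lemma volume_real_ball_inter_ball_le (x x' : Circ) {a : ℝ} (ha : a ≤ 1 / 2) :
    volume.real (Metric.ball x (a / 2) ∩ Metric.ball x' (a / 2)) ≤ max (a - ‖x - x'‖) 0 := by
  obtain ⟨z, hz⟩ := ball_inter_ball_subset x x' ha
  refine (measureReal_mono hz).trans ?_
  rw [Measure.real, AddCircle.volume_closedBall, mul_div_cancel₀ _ two_ne_zero, ENNReal.toReal_ofReal']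
  exact max_le_max (min_le_right _ _) le_rfl

lemma volume_real_avoiding_inter_le (x x' : Circ) {a : ℝ} (h0 : 0 ≤ a) (ha : a ≤ 1 / 2) :
    volume.real (avoiding x a ∩ avoiding x' a) ≤ 1 - 2 * a + max (a - ‖x - x'‖) 0 := by
  have h := measureReal_union_add_inter (μ := (volume : Measure Circ)) (s := Metric.ball x (a / 2))
    (t := Metric.ball x' (a / 2)) measurableSet_ball
  rw [volume_real_ball_circ x h0 (by linarith), volume_real_ball_circ x' h0 (by linarith)] at h
  rw [avoiding_eq_compl_ball, avoiding_eq_compl_ball, ← Set.compl_union,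
    measureReal_compl (measurableSet_ball.union measurableSet_ball)]
  have := volume_real_ball_inter_ball_le x x' ha
  simp only [probReal_univ]
  linarith

/-! ### The law of a single moving arc -/

/-- The centers and the waiting times of one arc. -/
abbrev Path : Type := (ℕ → Circ) × (ℕ → ℝ)

/-- The law of a sequence of independent uniform points. -/
abbrev centerLaw : Measure (ℕ → Circ) := Measure.infinitePi fun _ => volume

/-- The law of the input of one arc. -/
abbrev pathLaw : Measure Path := centerLaw.prod waitLaw

/-- The center of the arc at time `t`. -/
def position (t : ℝ) (s : Path) : Circ := s.1 (updateCount t s.2)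

lemma measurable_position : Measurable fun p : ℝ × Path => position p.1 p.2 := by
  have h1 : Measurable fun q : ℕ × (ℕ → Circ) => q.2 q.1 :=
    measurable_from_prod_countable_right fun n => measurable_pi_apply n
  have h2 : Measurable fun p : ℝ × Path => (updateCount p.1 p.2.2, p.2.1) :=
    (measurable_updateCount.comp (measurable_fst.prodMk measurable_snd.snd)).prodMk
      measurable_snd.fst
  exact h1.comp h2

lemma measurable_position_right (t : ℝ) : Measurable (position t) :=
  measurable_position.comp measurable_prodMk_left

lemma centerLaw_two (i j : ℕ) {A B : Set Circ} (hA : MeasurableSet A) (hB : MeasurableSet B) :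
    centerLaw {c | c i ∈ A ∧ c j ∈ B} =
      if i = j then volume (A ∩ B) else volume A * volume B := by
  split_ifs with h
  · subst h
    rw [← Measure.infinitePi_map_eval (fun _ : ℕ => (volume : Measure Circ)) i,
      Measure.map_apply (measurable_pi_apply i) (hA.inter hB)]
    rfl
  · have hi : IndepFun (fun c : ℕ → Circ => c i) (fun c => c j) centerLaw :=
      (iIndepFun_infinitePi (P := fun _ : ℕ => (volume : Measure Circ)) (X := fun _ => id)
        fun _ => measurable_id).indepFun h
    have := hi.measure_inter_preimage_eq_mul A B hA hB
    rw [← Measure.map_apply (measurable_pi_apply i) hA,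
      ← Measure.map_apply (measurable_pi_apply j) hB, Measure.infinitePi_map_eval,
      Measure.infinitePi_map_eval] at this
    exact this

/-- Given the waiting times, the two positions are the same uniform point if no update separates `s`
from `t`, and independent uniform points otherwise. -/
lemma pathLaw_position_pair {s t : ℝ} (hs : 0 ≤ s) (hst : s ≤ t) {A B : Set Circ}
    (hA : MeasurableSet A) (hB : MeasurableSet B) :
    pathLaw.real {p | position s p ∈ A ∧ position t p ∈ B} =
      Real.exp (-(t - s)) * volume.real (A ∩ B) +
        (1 - Real.exp (-(t - s))) * (volume.real A * volume.real B) := by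
  have hmeas : MeasurableSet {p | position s p ∈ A ∧ position t p ∈ B} :=
    (measurable_position_right s hA).inter (measurable_position_right t hB)
  have hE : MeasurableSet {y : ℕ → ℝ | updateCount s y = updateCount t y} :=
    measurableSet_eq_fun (measurable_updateCount_right s) (measurable_updateCount_right t)
  have hq := waitLaw_updateCount_eq hs hst
  have hqr : waitLaw.real {y | updateCount s y = updateCount t y} = Real.exp (-(t - s)) := by
    rw [Measure.real, hq, ENNReal.toReal_ofReal (Real.exp_pos _).le]
  have key : pathLaw {p | position s p ∈ A ∧ position t p ∈ B} =
      volume (A ∩ B) * waitLaw {y | updateCount s y = updateCount t y} +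
        (volume A * volume B) * waitLaw {y | updateCount s y = updateCount t y}ᶜ := by
    rw [Measure.prod_apply_symm hmeas, ← lintegral_indicator_const hE,
      ← lintegral_indicator_const hE.compl, ← lintegral_add_left (measurable_const.indicator hE)]
    refine lintegral_congr fun y => ?_
    have := centerLaw_two (updateCount s y) (updateCount t y) hA hB
    refine Eq.trans this ?_
    by_cases h : updateCount s y = updateCount t y
    · simp [h]
    · simp [h]
  rw [Measure.real, key, ENNReal.toReal_add (by finiteness) (by finiteness), ENNReal.toReal_mul,
    ENNReal.toReal_mul, ENNReal.toReal_mul]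
  change volume.real (A ∩ B) * waitLaw.real _ +
    volume.real A * volume.real B * waitLaw.real _ = _
  rw [measureReal_compl hE, hqr, probReal_univ]
  ring

lemma pathLaw_avoiding {t : ℝ} (ht : 0 ≤ t) (x : Circ) {a : ℝ} (h0 : 0 ≤ a) (h1 : a ≤ 1) :
    pathLaw.real {p | position t p ∈ avoiding x a} = 1 - a := by
  have := pathLaw_position_pair ht le_rfl (measurableSet_avoiding x a) (measurableSet_avoiding x a)
  simpa [volume_real_avoiding x h0 h1] using this

lemma pathLaw_avoiding_twice {s t : ℝ} (hs : 0 ≤ s) (hst : s ≤ t) (x : Circ) {a : ℝ} (h0 : 0 ≤ a)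
    (h1 : a ≤ 1) :
    pathLaw.real {p | position s p ∈ avoiding x a ∧ position t p ∈ avoiding x a} =
      (1 - a) * (1 - (1 - Real.exp (-(t - s))) * a) := by
  rw [pathLaw_position_pair hs hst (measurableSet_avoiding x a) (measurableSet_avoiding x a),
    Set.inter_self, volume_real_avoiding x h0 h1]
  ring

/-- With `g = max (a - s) 0`, the left side is at most `(1 - a)^2 + q g`. The constant `6` comes
from `1 / (1 - a)^2 ≤ 1 + 6 a` on `[0, 1/2]`, an equality at `1/2`; together with `g ≤ a` this gives
`g / (1 - a)^2 ≤ g + 6 a^2`. Finally `1 + x ≤ e^x`. -/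
lemma pair_correlation_bound {a s q v : ℝ} (h0 : 0 ≤ a) (ha : a ≤ 1 / 2) (hq0 : 0 ≤ q)
    (hq1 : q ≤ 1) (hs : 0 ≤ s) (hv : v ≤ 1 - 2 * a + max (a - s) 0) :
    q * v + (1 - q) * ((1 - a) * (1 - a)) ≤
      (1 - a) ^ 2 * Real.exp (q * max (a - s) 0 + 6 * a ^ 2) := by
  set g := max (a - s) 0 with hg
  have hg0 : 0 ≤ g := le_max_right _ _
  have hga : g ≤ a := max_le (by linarith) h0
  have h1 : q * v + (1 - q) * ((1 - a) * (1 - a)) ≤ (1 - a) ^ 2 + q * g := by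
    nlinarith [mul_nonneg hq0 (sub_nonneg.2 hv), mul_nonneg hq0 (sq_nonneg a)]
  have h2 : g ≤ (1 - a) ^ 2 * (g + 6 * a ^ 2) := by
    have h3 : 1 ≤ (1 - a) ^ 2 * (1 + 6 * a) := by
      nlinarith [mul_nonneg h0 (sub_nonneg.2 ha), mul_nonneg (mul_nonneg h0 (sub_nonneg.2 ha))
        (by linarith : 0 ≤ 4 - 3 * a)]
    have h4 : g ≤ g * ((1 - a) ^ 2 * (1 + 6 * a)) := le_mul_of_one_le_right hg0 h3
    nlinarith [mul_nonneg (mul_nonneg h0 (sub_nonneg.2 hga)) (sq_nonneg (1 - a))]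
  have h5 : q * g ≤ (1 - a) ^ 2 * (q * g + 6 * a ^ 2) := by
    have h6 := mul_le_mul_of_nonneg_left h2 hq0
    nlinarith [mul_nonneg (mul_nonneg (sub_nonneg.2 hq1) (sq_nonneg a)) (sq_nonneg (1 - a))]
  have h7 := Real.add_one_le_exp (q * g + 6 * a ^ 2)
  nlinarith [mul_le_mul_of_nonneg_left h7 (sq_nonneg (1 - a))]

lemma pathLaw_avoiding_pair_le {s t : ℝ} (hs : 0 ≤ s) (ht : 0 ≤ t) (x x' : Circ) {a : ℝ}
    (h0 : 0 ≤ a) (ha : a ≤ 1 / 2) :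
    pathLaw.real {p | position s p ∈ avoiding x a ∧ position t p ∈ avoiding x' a} ≤
      (1 - a) ^ 2 * Real.exp (Real.exp (-|s - t|) * max (a - ‖x - x'‖) 0 + 6 * a ^ 2) := by
  wlog hst : s ≤ t generalizing s t x x'
  · have := this ht hs x' x (le_of_not_ge hst)
    rw [abs_sub_comm, norm_sub_rev] at this
    convert this using 4
    exact and_comm
  rw [pathLaw_position_pair hs hst (measurableSet_avoiding x a) (measurableSet_avoiding x' a),
    volume_real_avoiding x h0 (by linarith), volume_real_avoiding x' h0 (by linarith),
    abs_sub_comm, abs_of_nonneg (sub_nonneg.2 hst)]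
  exact pair_correlation_bound h0 ha (Real.exp_pos _).le (Real.exp_le_one_iff.2 (by linarith))
    (norm_nonneg _) (volume_real_avoiding_inter_le x x' h0 ha)

/-- The arc of length `a` covers `x` and makes no update during `[0, 1]`. -/
def permanentCover (x : Circ) (a : ℝ) : Set Path := {p | p.1 0 ∈ Metric.ball x (a / 2) ∧ 1 < p.2 0}

lemma measurableSet_permanentCover (x : Circ) (a : ℝ) : MeasurableSet (permanentCover x a) :=
  (measurableSet_ball.preimage ((measurable_pi_apply 0).comp measurable_fst)).inter
    (measurableSet_lt measurable_const ((measurable_pi_apply 0).comp measurable_snd))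

lemma pathLaw_permanentCover (x : Circ) {a : ℝ} (h0 : 0 ≤ a) (h1 : a ≤ 1) :
    pathLaw.real (permanentCover x a) = a * Real.exp (-1) := by
  have h : permanentCover x a =
      ((fun c : ℕ → Circ => c 0) ⁻¹' Metric.ball x (a / 2)) ×ˢ ((fun y : ℕ → ℝ => y 0) ⁻¹' Set.Ioi 1) :=
    rfl
  rw [h, Measure.real, Measure.prod_prod, ← Measure.map_apply (measurable_pi_apply 0) measurableSet_ball,
    ← Measure.map_apply (measurable_pi_apply 0) measurableSet_Ioi, Measure.infinitePi_map_eval,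
    Measure.infinitePi_map_eval, ENNReal.toReal_mul, expMeasure_Ioi zero_le_one,
    ENNReal.toReal_ofReal (Real.exp_pos _).le]
  congr 1
  exact volume_real_ball_circ x h0 h1

lemma position_mem_ball_of_mem_permanentCover {p : Path} (hp : Regular p.2) {x : Circ} {a : ℝ}
    (h : p ∈ permanentCover x a) {t : ℝ} (ht : t ∈ Set.Icc (0 : ℝ) 1) :
    position t p ∈ Metric.ball x (a / 2) := by
  have : updateCount t p.2 = 0 := by
    rw [hp.updateCount_eq_iff ht.1]
    refine ⟨by simpa using ht.1, ?_⟩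
    rw [arrival_succ]
    have := h.2
    simp only [arrival_zero]
    linarith [ht.2]
  rw [position, this]
  exact h.1

/-! ### Independence of the arcs -/

lemma iIndep_iSup_of_pairwise_disjoint {Ω ι κ : Type*} {m0 : MeasurableSpace Ω}
    {m : ι → MeasurableSpace Ω} {P : Measure Ω} [IsProbabilityMeasure P] (hle : ∀ i, m i ≤ m0)
    (h : iIndep m P) {S : κ → Set ι} (hS : Pairwise fun k l => Disjoint (S k) (S l)) :
    iIndep (fun k => ⨆ i ∈ S k, m i) P := by
  classical
  rw [iIndep_iff]
  intro t f hf
  induction t using Finset.induction_on with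
  | empty => simp
  | insert a t ha ih =>
    have hd : Disjoint (S a) (⋃ k ∈ t, S k) := by
      rw [Set.disjoint_iUnion₂_right]
      exact fun k hk => hS fun h => ha (h ▸ hk)
    have hi := indep_iSup_of_disjoint hle h hd
    rw [Finset.set_biInter_insert, Finset.prod_insert ha,
      ← ih fun i hi => hf i (Finset.mem_insert_of_mem hi)]
    refine (Indep_iff _ _ P).1 hi _ _ (hf a (Finset.mem_insert_self a t)) ?_
    refine Finset.measurableSet_biInter t fun k hk => ?_
    refine (iSup₂_le fun i hi => ?_ : (⨆ i ∈ S k, m i) ≤ _) _ (hf k (Finset.mem_insert_of_mem hk))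
    exact le_iSup₂_of_le i (Set.mem_biUnion hk hi) le_rfl

/-- Independent arcs, all moving with the law `pathLaw`. -/
structure IsArcSystem {Ω : Type*} [MeasurableSpace Ω] (P : Measure Ω) (ξ : ℕ → Ω → Path) :
    Prop where
  measurable : ∀ i, Measurable (ξ i)
  law : ∀ i, P.map (ξ i) = pathLaw
  indep : iIndepFun ξ P

/-- The input of the `i`-th arc. -/
def inputPath {Ω : Type*} (C : ℕ → ℕ → Ω → Circ) (Y : ℕ → ℕ → Ω → ℝ) (i : ℕ) (ω : Ω) : Path :=
  (fun j => C i j ω, fun j => Y i j ω)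

lemma measurable_inputPath_of_le {Ω : Type*} {m : MeasurableSpace Ω} {C : ℕ → ℕ → Ω → Circ}
    {Y : ℕ → ℕ → Ω → ℝ} {i : ℕ} (hC : ∀ j, Measurable (C i j)) (hY : ∀ j, Measurable (Y i j)) :
    Measurable (inputPath C Y i) :=
  (measurable_pi_lambda _ hC).prodMk (measurable_pi_lambda _ hY)

/-- Grouping the independent variables by their first index makes the arcs independent. For `α = 0`
every waiting parameter is `(ℓ i) ^ 0 = 1`, so all arcs share one law. -/
lemma IsPoissonInput.isArcSystem {Ω : Type*} [MeasurableSpace Ω] {P : Measure Ω}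
    [IsProbabilityMeasure P] {ℓ : ℕ → ℝ} {C : ℕ → ℕ → Ω → Circ} {Y : ℕ → ℕ → Ω → ℝ}
    (h : IsPoissonInput P 0 ℓ C Y) : IsArcSystem P (inputPath C Y) := by
  set m : ℕ × ℕ ⊕ ℕ × ℕ → MeasurableSpace Ω := Sum.elim
    (fun p : ℕ × ℕ => MeasurableSpace.comap (C p.1 p.2) inferInstance)
    (fun p : ℕ × ℕ => MeasurableSpace.comap (Y p.1 p.2) inferInstance) with hm
  have hle : ∀ s, m s ≤ ‹MeasurableSpace Ω› := by
    rintro (p | p)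
    · exact (h.measurable_center p.1 p.2).comap_le
    · exact (h.measurable_wait p.1 p.2).comap_le
  have hind : iIndep m P := h.indep
  have hmeas : ∀ i, Measurable (inputPath C Y i) := fun i =>
    measurable_inputPath_of_le (h.measurable_center i) (h.measurable_wait i)
  have hcm : ∀ (S : Set (ℕ × ℕ ⊕ ℕ × ℕ)) (i j : ℕ), Sum.inl (i, j) ∈ S →
      Measurable[⨆ s ∈ S, m s] (C i j) := fun S i j hS =>
    Measurable.mono (comap_measurable (C i j)) (le_iSup₂_of_le (f := fun s (_ : s ∈ S) => m s) _ hS le_rfl) le_rfl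
  have hym : ∀ (S : Set (ℕ × ℕ ⊕ ℕ × ℕ)) (i j : ℕ), Sum.inr (i, j) ∈ S →
      Measurable[⨆ s ∈ S, m s] (Y i j) := fun S i j hS =>
    Measurable.mono (comap_measurable (Y i j)) (le_iSup₂_of_le (f := fun s (_ : s ∈ S) => m s) _ hS le_rfl) le_rfl
  refine ⟨hmeas, fun i => ?_, ?_⟩
  · have hC : iIndepFun (fun j => C i j) P :=
      hind.precomp (g := fun j : ℕ => Sum.inl (i, j)) fun a b hab => by simpa using hab
    have hY : iIndepFun (fun j => Y i j) P :=
      hind.precomp (g := fun j : ℕ => Sum.inr (i, j)) fun a b hab => by simpa using hab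
    have hCY : IndepFun (fun ω j => C i j ω) (fun ω j => Y i j ω) P := by
      have hd : Disjoint (Set.range fun j : ℕ => (Sum.inl (i, j) : ℕ × ℕ ⊕ ℕ × ℕ))
          (Set.range fun j : ℕ => (Sum.inr (i, j) : ℕ × ℕ ⊕ ℕ × ℕ)) := by
        rw [Set.disjoint_left]
        rintro _ ⟨j, rfl⟩ ⟨k, hk⟩
        simp at hk
      refine indep_of_indep_of_le (indep_iSup_of_disjoint hle hind hd) ?_ ?_
      · exact Measurable.comap_le (@measurable_pi_lambda _ _ _ (_) _ _ fun j => hcm _ i j ⟨j, rfl⟩)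
      · exact Measurable.comap_le (@measurable_pi_lambda _ _ _ (_) _ _ fun j => hym _ i j ⟨j, rfl⟩)
    have h1 := (iIndepFun_iff_map_fun_eq_infinitePi_map (h.measurable_center i)).1 hC
    have h2 := (iIndepFun_iff_map_fun_eq_infinitePi_map (h.measurable_wait i)).1 hY
    have h3 := (indepFun_iff_map_prod_eq_prod_map_map
      (measurable_pi_lambda _ (h.measurable_center i)).aemeasurable
      (measurable_pi_lambda _ (h.measurable_wait i)).aemeasurable).1 hCY
    have h4 : P.map (inputPath C Y i) = P.map (fun ω => (fun j => C i j ω, fun j => Y i j ω)) := rfl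
    have h5 : ∀ j, P.map (Y i j) = expMeasure 1 := fun j => by
      rw [h.law_wait, neg_zero, Real.rpow_zero]
    rw [h4, h3, h1, h2]
    simp_rw [h5, h.law_center]
  · have hd : Pairwise fun k l : ℕ =>
        Disjoint {s : ℕ × ℕ ⊕ ℕ × ℕ | Sum.elim Prod.fst Prod.fst s = k}
          {s : ℕ × ℕ ⊕ ℕ × ℕ | Sum.elim Prod.fst Prod.fst s = l} := by
      intro k l hkl
      rw [Set.disjoint_left]
      exact fun s h1 h2 => hkl (h1.symm.trans h2)
    refine iIndep_of_iIndep_of_le (iIndep_iSup_of_pairwise_disjoint hle hind hd) fun i => ?_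
    exact Measurable.comap_le (measurable_inputPath_of_le (fun j => hcm _ i j rfl)
      fun j => hym _ i j rfl)

lemma center_eq_position {Ω : Type*} (C : ℕ → ℕ → Ω → Circ) (Y : ℕ → ℕ → Ω → ℝ) (i : ℕ) {t : ℝ}
    (ht : 0 ≤ t) {ω : Ω} (hreg : Regular (inputPath C Y i ω).2) :
    center C Y i t ω = position t (inputPath C Y i ω) := by
  have hmem : ∀ j, t ∈ Set.Ico (updateTime Y i j ω) (updateTime Y i (j + 1) ω) ↔
      updateCount t (inputPath C Y i ω).2 = j := fun j => (hreg.updateCount_eq_iff ht j).symm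
  rw [center, tsum_eq_single (updateCount t (inputPath C Y i ω).2)]
  · rw [Set.indicator_of_mem ((hmem _).2 rfl)]
    rfl
  · intro j hj
    exact Set.indicator_of_notMem (fun h => hj ((hmem j).1 h).symm) _

/-- Conditionally on the previous update time, the last wait would have to take one prescribed
value. -/
lemma waitLaw_arrival_eq (j : ℕ) (s : ℝ) : waitLaw {y | arrival y (j + 1) = s} = 0 := by
  have hlaw := (indepFun_iff_map_prod_eq_prod_map_map (measurable_arrival j).aemeasurable
    (measurable_pi_apply j).aemeasurable).1 (indepFun_arrival_wait j)
  rw [Measure.infinitePi_map_eval] at hlaw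
  have hmeas : MeasurableSet {p : ℝ × ℝ | p.1 + p.2 = s} :=
    measurableSet_eq_fun (measurable_fst.add measurable_snd) measurable_const
  have : {y : ℕ → ℝ | arrival y (j + 1) = s} =
      (fun y => (arrival y j, y j)) ⁻¹' {p : ℝ × ℝ | p.1 + p.2 = s} := by
    ext y
    simp [arrival_succ]
  rw [this, ← Measure.map_apply ((measurable_arrival j).prodMk (measurable_pi_apply j)) hmeas, hlaw,
    Measure.prod_apply hmeas, lintegral_eq_zero_iff' (measurable_measure_prodMk_left hmeas).aemeasurable]
  refine Eventually.of_forall fun a => ?_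
  refine measure_mono_null (t := {s - a}) (fun b hb => ?_) (expMeasure_singleton _)
  have hb' : a + b = s := hb
  simp only [Set.mem_singleton_iff]
  linarith

/-- The information on the arcs with index in `s`. -/
@[reducible] def arcSigma {Ω : Type*} (ξ : ℕ → Ω → Path) (s : Set ℕ) : MeasurableSpace Ω :=
  ⨆ i ∈ s, MeasurableSpace.comap (ξ i) inferInstance

lemma measurable_arcSigma {Ω : Type*} {ξ : ℕ → Ω → Path} {s : Set ℕ} {i : ℕ} (hi : i ∈ s) : Measurable[arcSigma ξ s] (ξ i) :=
  Measurable.mono (comap_measurable (ξ i))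
    (le_iSup₂_of_le (f := fun i (_ : i ∈ s) => MeasurableSpace.comap (ξ i) inferInstance) i hi le_rfl)
    le_rfl

namespace IsArcSystem

variable {Ω : Type*} [MeasurableSpace Ω] {P : Measure Ω} {ξ : ℕ → Ω → Path}

lemma ae_of_pathLaw (h : IsArcSystem P ξ) {p : Path → Prop} (hp : ∀ᵐ s ∂pathLaw, p s) (i : ℕ) :
    ∀ᵐ ω ∂P, p (ξ i ω) := by
  rw [← h.law i] at hp
  exact ae_of_ae_map (h.measurable i).aemeasurable hp

lemma ae_regular (h : IsArcSystem P ξ) : ∀ᵐ ω ∂P, ∀ i, Regular (ξ i ω).2 := by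
  rw [ae_all_iff]
  refine fun i => h.ae_of_pathLaw (p := fun s => Regular s.2) ?_ i
  exact Measure.quasiMeasurePreserving_snd.ae ae_regular_waitLaw

/-- Independence and the absence of atoms. In the compactness argument this ensures that at most one
arc jumps at the limit time. -/
lemma ae_no_common_update [IsProbabilityMeasure P] (h : IsArcSystem P ξ) :
    ∀ᵐ ω ∂P, ∀ i i', i ≠ i' → ∀ j j', arrival (ξ i ω).2 (j + 1) ≠ arrival (ξ i' ω).2 (j' + 1) := by
  simp only [ae_all_iff]
  intro i i' hne j j'
  have hlaw := (indepFun_iff_map_prod_eq_prod_map_map (h.measurable i).aemeasurable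
    (h.measurable i').aemeasurable).1 (h.indep.indepFun hne)
  rw [h.law, h.law] at hlaw
  have hm : ∀ k, Measurable fun p : Path => arrival p.2 k := fun k =>
    (measurable_arrival k).comp measurable_snd
  have hmeas : MeasurableSet {p : Path × Path | arrival p.1.2 (j + 1) = arrival p.2.2 (j' + 1)} :=
    measurableSet_eq_fun ((hm _).comp measurable_fst) ((hm _).comp measurable_snd)
  rw [ae_iff]
  have : {ω | ¬ arrival (ξ i ω).2 (j + 1) ≠ arrival (ξ i' ω).2 (j' + 1)} =
      (fun ω => (ξ i ω, ξ i' ω)) ⁻¹'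
        {p : Path × Path | arrival p.1.2 (j + 1) = arrival p.2.2 (j' + 1)} := by
    ext ω
    simp
  rw [this, ← Measure.map_apply ((h.measurable i).prodMk (h.measurable i')) hmeas, hlaw,
    Measure.prod_apply_symm hmeas,
    lintegral_eq_zero_iff' (measurable_measure_prodMk_right hmeas).aemeasurable]
  refine Eventually.of_forall fun p => ?_
  change pathLaw ((fun q : Path => q.2) ⁻¹' {y | arrival y (j + 1) = arrival p.2 (j' + 1)}) = 0
  exact Measure.quasiMeasurePreserving_snd.preimage_null (waitLaw_arrival_eq j _)

lemma measureReal_preimage (h : IsArcSystem P ξ) (i : ℕ) {A : Set Path} (hA : MeasurableSet A) :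
    P.real (ξ i ⁻¹' A) = pathLaw.real A := by
  rw [← h.law i, measureReal_def, measureReal_def, Measure.map_apply (h.measurable i) hA]

lemma measureReal_biInter (h : IsArcSystem P ξ) (s : Finset ℕ) {A : ℕ → Set Path}
    (hA : ∀ i, MeasurableSet (A i)) :
    P.real (⋂ i ∈ s, ξ i ⁻¹' A i) = ∏ i ∈ s, pathLaw.real (A i) := by
  rw [measureReal_def, h.indep.measure_inter_preimage_eq_mul s fun i _ => hA i, ENNReal.toReal_prod]
  exact Finset.prod_congr rfl fun i _ => h.measureReal_preimage i (hA i)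

lemma arcSigma_le (h : IsArcSystem P ξ) (s : Set ℕ) : arcSigma ξ s ≤ ‹MeasurableSpace Ω› :=
  iSup₂_le fun i _ => (h.measurable i).comap_le

lemma measureReal_inter_of_disjoint (h : IsArcSystem P ξ) {s t : Set ℕ} (hst : Disjoint s t)
    {A B : Set Ω} (hA : MeasurableSet[arcSigma ξ s] A) (hB : MeasurableSet[arcSigma ξ t] B) :
    P.real (A ∩ B) = P.real A * P.real B := by
  have := indep_iSup_of_disjoint (fun i => (h.measurable i).comap_le) h.indep.iIndep hst
  rw [measureReal_def, (Indep_iff _ _ P).1 this A B hA hB, ENNReal.toReal_mul]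
  rfl

end IsArcSystem

/-! ### Points that are uncovered at some time -/

/-- At time `t` the point `x` lies in none of the arcs with index in `s` and lengths `b`. -/
def missedAt {Ω : Type*} (ξ : ℕ → Ω → Path) (b : ℕ → ℝ) (s : Finset ℕ) (x : Circ) (t : ℝ) : Set Ω :=
  ⋂ i ∈ s, ξ i ⁻¹' {p | position t p ∈ avoiding x (b i)}

/-- At some dyadic time in `[0, 1]` the point `x` lies in none of the arcs with index in `s` and
lengths `b`. -/
def missedSometime {Ω : Type*} (ξ : ℕ → Ω → Path) (b : ℕ → ℝ) (s : Finset ℕ) (x : Circ) : Set Ω :=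
  ⋃ k : ℕ, ⋃ r ∈ Finset.range (2 ^ k + 1), missedAt ξ b s x ((r : ℝ) / (2 ^ k : ℕ))

lemma measurableSet_position_avoiding (t : ℝ) (x : Circ) (a : ℝ) :
    MeasurableSet {p : Path | position t p ∈ avoiding x a} :=
  measurable_position_right t (measurableSet_avoiding x a)

lemma measurableSet_missedAt {Ω : Type*} (ξ : ℕ → Ω → Path) (b : ℕ → ℝ) (s : Finset ℕ) (x : Circ)
    (t : ℝ) : MeasurableSet[arcSigma ξ s] (missedAt ξ b s x t) := by
  refine @Finset.measurableSet_biInter _ _ (arcSigma ξ s) _ s fun i hi => ?_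
  exact measurable_arcSigma (ξ := ξ) (s := (s : Set ℕ)) hi (measurableSet_position_avoiding t x (b i))

lemma measurableSet_missedSometime {Ω : Type*} (ξ : ℕ → Ω → Path) (b : ℕ → ℝ) (s : Finset ℕ)
    (x : Circ) : MeasurableSet[arcSigma ξ s] (missedSometime ξ b s x) := by
  refine @MeasurableSet.iUnion _ _ (arcSigma ξ s) _ _ fun k => ?_
  exact @Finset.measurableSet_biUnion _ _ (arcSigma ξ s) _ _ fun r _ =>
    measurableSet_missedAt ξ b s x _

lemma one_sub_sum_le_prod_one_sub {ι : Type*} (s : Finset ι) {c : ι → ℝ} (h0 : ∀ i ∈ s, 0 ≤ c i)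
    (h1 : ∀ i ∈ s, c i ≤ 1) : 1 - ∑ i ∈ s, c i ≤ ∏ i ∈ s, (1 - c i) := by
  classical
  induction s using Finset.induction_on with
  | empty => simp
  | insert a s ha ih =>
    rw [Finset.sum_insert ha, Finset.prod_insert ha]
    have h2 := ih (fun i hi => h0 i (Finset.mem_insert_of_mem hi))
      fun i hi => h1 i (Finset.mem_insert_of_mem hi)
    have h3 := h0 a (Finset.mem_insert_self a s)
    have h4 := h1 a (Finset.mem_insert_self a s)
    have h5 : 0 ≤ ∑ i ∈ s, c i := Finset.sum_nonneg fun i hi => h0 i (Finset.mem_insert_of_mem hi)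
    nlinarith [mul_le_mul_of_nonneg_left h2 (sub_nonneg.2 h4), mul_nonneg h3 h5]

namespace IsArcSystem

variable {Ω : Type*} [MeasurableSpace Ω] {P : Measure Ω} {ξ : ℕ → Ω → Path}

lemma measureReal_missedAt (h : IsArcSystem P ξ) {b : ℕ → ℝ} {s : Finset ℕ}
    (h0 : ∀ i ∈ s, 0 ≤ b i) (h1 : ∀ i ∈ s, b i ≤ 1) (x : Circ) {t : ℝ} (ht : 0 ≤ t) :
    P.real (missedAt ξ b s x t) = ∏ i ∈ s, (1 - b i) := by
  rw [missedAt, h.measureReal_biInter s fun i => measurableSet_position_avoiding t x (b i)]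
  exact Finset.prod_congr rfl fun i hi => pathLaw_avoiding ht x (h0 i hi) (h1 i hi)

/-- The probability of being missed at both times is `∏ (1 - b_i)` times `∏ (1 - (1 - e^{-(t'-t)})
b_i)`. The second product is bounded below by Weierstrass' inequality and `1 - e^{-x} ≤ x`. -/
lemma measureReal_missedAt_diff_le [IsProbabilityMeasure P] (h : IsArcSystem P ξ) {b : ℕ → ℝ}
    {s : Finset ℕ} (h0 : ∀ i ∈ s, 0 ≤ b i) (h1 : ∀ i ∈ s, b i ≤ 1) (x : Circ) {t t' : ℝ}
    (ht : 0 ≤ t) (htt : t ≤ t') :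
    P.real (missedAt ξ b s x t' \ missedAt ξ b s x t) ≤
      (∏ i ∈ s, (1 - b i)) * ((t' - t) * ∑ i ∈ s, b i) := by
  have hinter : missedAt ξ b s x t' ∩ missedAt ξ b s x t =
      ⋂ i ∈ s, ξ i ⁻¹' {p | position t p ∈ avoiding x (b i) ∧ position t' p ∈ avoiding x (b i)} := by
    ext ω
    simp only [missedAt, Set.mem_inter_iff, Set.mem_iInter, Set.mem_preimage, Set.mem_ofPred_eq]
    exact ⟨fun h i hi => ⟨h.2 i hi, h.1 i hi⟩, fun h => ⟨fun i hi => (h i hi).2, fun i hi => (h i hi).1⟩⟩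
  have h2 := measureReal_inter_add_sdiff (μ := P) (s := missedAt ξ b s x t')
    (h.arcSigma_le _ _ (measurableSet_missedAt ξ b s x t))
  rw [hinter, h.measureReal_biInter s
    (A := fun i => {p | position t p ∈ avoiding x (b i) ∧ position t' p ∈ avoiding x (b i)})
    fun i => (measurableSet_position_avoiding t x (b i)).inter
      (measurableSet_position_avoiding t' x (b i)), h.measureReal_missedAt h0 h1 x (ht.trans htt),
    Finset.prod_congr rfl fun i hi => pathLaw_avoiding_twice ht htt x (h0 i hi) (h1 i hi),
    Finset.prod_mul_distrib] at h2
  have hq : 1 - Real.exp (-(t' - t)) ≤ t' - t := by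
    linarith [Real.add_one_le_exp (-(t' - t))]
  have hq0 : 0 ≤ 1 - Real.exp (-(t' - t)) := by
    have : Real.exp (-(t' - t)) ≤ 1 := Real.exp_le_one_iff.2 (by linarith)
    linarith
  have hq1 : 1 - Real.exp (-(t' - t)) ≤ 1 := by linarith [Real.exp_pos (-(t' - t))]
  have h3 := one_sub_sum_le_prod_one_sub s (c := fun i => (1 - Real.exp (-(t' - t))) * b i)
    (fun i hi => mul_nonneg hq0 (h0 i hi)) (fun i hi => mul_le_one₀ hq1 (h0 i hi) (h1 i hi))
  rw [← Finset.mul_sum] at h3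
  have hU : 0 ≤ ∏ i ∈ s, (1 - b i) := Finset.prod_nonneg fun i hi => sub_nonneg.2 (h1 i hi)
  have hS : 0 ≤ ∑ i ∈ s, b i := Finset.sum_nonneg h0
  have h4 := mul_le_mul_of_nonneg_left h3 hU
  have h5 := mul_le_mul_of_nonneg_left (mul_le_mul_of_nonneg_right hq hS) hU
  linarith

/-- Union bound over entrances: a point missed at some grid time is missed at time `0` or becomes
missed between two consecutive grid times. -/
lemma measureReal_missed_grid_le [IsProbabilityMeasure P] (h : IsArcSystem P ξ) {b : ℕ → ℝ}
    {s : Finset ℕ} (h0 : ∀ i ∈ s, 0 ≤ b i) (h1 : ∀ i ∈ s, b i ≤ 1) (x : Circ) {R : ℕ} (hR : 0 < R)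
    (k : ℕ) :
    P.real (⋃ r ∈ Finset.range (k + 1), missedAt ξ b s x ((r : ℝ) / R)) ≤
      (∏ i ∈ s, (1 - b i)) * (1 + k / R * ∑ i ∈ s, b i) := by
  have hR' : (0 : ℝ) < R := by exact_mod_cast hR
  induction k with
  | zero => simp [h.measureReal_missedAt h0 h1 x le_rfl]
  | succ k ih =>
    have hsub : (⋃ r ∈ Finset.range (k + 1 + 1), missedAt ξ b s x ((r : ℝ) / R)) ⊆
        (⋃ r ∈ Finset.range (k + 1), missedAt ξ b s x ((r : ℝ) / R)) ∪
          (missedAt ξ b s x (((k + 1 : ℕ) : ℝ) / R) \ missedAt ξ b s x ((k : ℝ) / R)) := by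
      rw [Finset.range_add_one, Finset.set_biUnion_insert]
      rintro ω (hω | hω)
      · by_cases hk : ω ∈ missedAt ξ b s x ((k : ℝ) / R)
        · exact Or.inl (Set.mem_biUnion (Finset.self_mem_range_succ k) hk)
        · exact Or.inr ⟨hω, hk⟩
      · exact Or.inl hω
    refine (measureReal_mono hsub).trans ((measureReal_union_le _ _).trans ?_)
    have h2 := h.measureReal_missedAt_diff_le h0 h1 x (t := (k : ℝ) / R)
      (t' := ((k + 1 : ℕ) : ℝ) / R) (by positivity) (by gcongr; simp)
    refine (add_le_add ih h2).trans (le_of_eq ?_)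
    push_cast
    field_simp
    ring

/-- On the whole of `[0, 1]` the grid bound does not depend on the mesh, so it passes to the
increasing union of the dyadic grids. The factor `1 + ∑ b_i` is the source of `log n` in part (i).
-/
lemma measureReal_missedSometime_le [IsProbabilityMeasure P] (h : IsArcSystem P ξ) {b : ℕ → ℝ}
    {s : Finset ℕ} (h0 : ∀ i ∈ s, 0 ≤ b i) (h1 : ∀ i ∈ s, b i ≤ 1) (x : Circ) :
    P.real (missedSometime ξ b s x) ≤ (∏ i ∈ s, (1 - b i)) * (1 + ∑ i ∈ s, b i) := by
  have hmono : Monotone fun k : ℕ =>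
      ⋃ r ∈ Finset.range (2 ^ k + 1), missedAt ξ b s x ((r : ℝ) / (2 ^ k : ℕ)) := by
    refine monotone_nat_of_le_succ fun k => ?_
    refine Set.iUnion₂_subset fun r hr => ?_
    have hr' : 2 * r ∈ Finset.range (2 ^ (k + 1) + 1) := by
      rw [Finset.mem_range] at hr ⊢
      rw [pow_succ]
      omega
    refine Set.subset_biUnion_of_mem (u := fun r : ℕ => missedAt ξ b s x ((r : ℝ) / (2 ^ (k + 1) : ℕ)))
      hr' |>.trans' (le_of_eq ?_)
    congr 1
    push_cast
    rw [pow_succ]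
    field_simp
  have hlim := tendsto_measure_iUnion_atTop (μ := P) hmono
  have hlim' := (ENNReal.tendsto_toReal (measure_ne_top P _)).comp hlim
  refine le_of_tendsto' hlim' fun k => ?_
  refine (h.measureReal_missed_grid_le h0 h1 x (R := 2 ^ k) (by positivity) (2 ^ k)).trans
    (le_of_eq ?_)
  rw [div_self (by positivity), one_mul]

/-! ### Covering finitely many points permanently -/

lemma measureReal_biUnion_ge [IsProbabilityMeasure P] (h : IsArcSystem P ξ) {G : ℕ → Set Path}
    (hG : ∀ i, MeasurableSet (G i)) {p : ℝ} (s : Finset ℕ) (hp : ∀ i ∈ s, p ≤ pathLaw.real (G i)) :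
    1 - (1 - p) ^ s.card ≤ P.real (⋃ i ∈ s, ξ i ⁻¹' G i) := by
  have hm : MeasurableSet (⋃ i ∈ s, ξ i ⁻¹' G i) :=
    Finset.measurableSet_biUnion s fun i _ => h.measurable i (hG i)
  have h1 : P.real (⋃ i ∈ s, ξ i ⁻¹' G i)ᶜ ≤ (1 - p) ^ s.card := by
    simp only [Set.compl_iUnion, ← Set.preimage_compl]
    rw [h.measureReal_biInter s fun i => (hG i).compl, ← Finset.prod_const]
    refine Finset.prod_le_prod (fun i _ => measureReal_nonneg) fun i hi => ?_
    rw [measureReal_compl (hG i), probReal_univ]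
    linarith [hp i hi]
  rw [measureReal_compl hm, probReal_univ] at h1
  linarith

/-- Each `q ∈ B` receives its own block of `R` consecutive arcs. The blocks are disjoint, hence
independent, and the induction peels them off one at a time, which is why the start `a` is left
free. -/
lemma measureReal_biInter_biUnion_ge [IsProbabilityMeasure P] (h : IsArcSystem P ξ)
    {κ : Type*} {G : κ → ℕ → Set Path} (hG : ∀ q i, MeasurableSet (G q i)) {p : ℝ}
    {N R : ℕ} (hp : ∀ q, ∀ i < N, p ≤ pathLaw.real (G q i)) (B : Finset κ) :
    ∀ a : ℕ, a + B.card * R ≤ N → 0 ≤ 1 - (1 - p) ^ R →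
      (1 - (1 - p) ^ R) ^ B.card ≤
        P.real (⋂ q ∈ B, ⋃ i ∈ Finset.Ico a (a + B.card * R), ξ i ⁻¹' G q i) := by
  classical
  induction B using Finset.induction_on with
  | empty => simp
  | insert q B hq ih =>
    intro a ha hc
    rw [Finset.card_insert_of_notMem hq] at ha ⊢
    rw [Finset.set_biInter_insert]
    have ha' : a + R + B.card * R ≤ N := by
      calc a + R + B.card * R = a + (B.card + 1) * R := by ring
        _ ≤ N := ha
    have hend : a + (B.card + 1) * R = a + R + B.card * R := by ring
    have hmeas : ∀ (q : κ) (u v : ℕ), MeasurableSet[arcSigma ξ (Set.Ico u v)]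
        (⋃ i ∈ Finset.Ico u v, ξ i ⁻¹' G q i) := fun q u v =>
      @Finset.measurableSet_biUnion _ _ (arcSigma ξ (Set.Ico u v)) _ _ fun i hi =>
        measurable_arcSigma (ξ := ξ) (s := Set.Ico u v) (by simpa using hi) (hG q i)
    have h1 : (⋃ i ∈ Finset.Ico a (a + R), ξ i ⁻¹' G q i) ∩
        (⋂ q ∈ B, ⋃ i ∈ Finset.Ico (a + R) (a + R + B.card * R), ξ i ⁻¹' G q i) ⊆
        (⋃ i ∈ Finset.Ico a (a + (B.card + 1) * R), ξ i ⁻¹' G q i) ∩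
          ⋂ q ∈ B, ⋃ i ∈ Finset.Ico a (a + (B.card + 1) * R), ξ i ⁻¹' G q i := by
      rw [hend]
      refine Set.inter_subset_inter ?_ (Set.iInter₂_mono fun q _ => ?_)
      · exact Set.biUnion_mono (fun i hi => by simp at hi ⊢; omega) fun _ _ => le_rfl
      · exact Set.biUnion_mono (fun i hi => by simp at hi ⊢; omega) fun _ _ => le_rfl
    refine le_trans ?_ (measureReal_mono h1)
    rw [h.measureReal_inter_of_disjoint (s := Set.Ico a (a + R))
      (t := Set.Ico (a + R) (a + R + B.card * R)) ?_ (hmeas q _ _)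
      (@Finset.measurableSet_biInter _ _ (arcSigma ξ _) _ B fun q _ => hmeas q _ _), pow_succ, mul_comm]
    · refine mul_le_mul ?_ (ih (a + R) ha' hc) (pow_nonneg hc _) measureReal_nonneg
      have := h.measureReal_biUnion_ge (hG q) (Finset.Ico a (a + R))
        (p := p) fun i hi => hp q i (by rw [Finset.mem_Ico] at hi; omega)
      simpa using this
    · rw [Set.disjoint_left]
      intro i hi hi'
      exact absurd hi.2 (not_lt.2 hi'.1)

end IsArcSystem

/-! ### Existence of an uncovered point for finitely many arcs -/

/-- At some dyadic time in `[0, 1]` the arcs with index in `s` do not cover the circle. -/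
def exposed {Ω : Type*} (ξ : ℕ → Ω → Path) (ℓ : ℕ → ℝ) (s : Finset ℕ) : Set Ω :=
  {ω | ∃ k r : ℕ, r ≤ 2 ^ k ∧ ∃ x, ω ∈ missedAt ξ ℓ s x ((r : ℝ) / (2 ^ k : ℕ))}

/-- A projection along a compact circle is a closed map. This makes `exposed` measurable although
`x` ranges over an uncountable set. -/
lemma isClosed_exists_avoiding {ι : Type*} (ℓ : ι → ℝ) :
    IsClosed {c : ι → Circ | ∃ x, ∀ i, c i ∈ avoiding x (ℓ i)} := by
  have h : {c : ι → Circ | ∃ x, ∀ i, c i ∈ avoiding x (ℓ i)} =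
      Prod.snd '' {q : Circ × (ι → Circ) | ∀ i, ℓ i / 2 ≤ ‖q.1 - q.2 i‖} := by
    ext c
    simp [avoiding]
  rw [h]
  refine isClosedMap_snd_of_compactSpace _ ?_
  have h2 : {q : Circ × (ι → Circ) | ∀ i, ℓ i / 2 ≤ ‖q.1 - q.2 i‖} =
      ⋂ i, {q : Circ × (ι → Circ) | ℓ i / 2 ≤ ‖q.1 - q.2 i‖} := by
    ext q
    simp
  rw [h2]
  refine isClosed_iInter fun i => isClosed_le continuous_const ?_
  fun_prop

lemma measurableSet_exposed {Ω : Type*} (ξ : ℕ → Ω → Path) (ℓ : ℕ → ℝ) (s : Finset ℕ) :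
    MeasurableSet[arcSigma ξ s] (exposed ξ ℓ s) := by
  have h : exposed ξ ℓ s = ⋃ k : ℕ, ⋃ r ∈ Finset.range (2 ^ k + 1),
      (fun ω (i : s) => position ((r : ℝ) / (2 ^ k : ℕ)) (ξ i ω)) ⁻¹'
        {c : s → Circ | ∃ x, ∀ i : s, c i ∈ avoiding x (ℓ i)} := by
    ext ω
    simp [exposed, missedAt]
  rw [h]
  refine @MeasurableSet.iUnion _ _ (arcSigma ξ s) _ _ fun k => ?_
  refine @Finset.measurableSet_biUnion _ _ (arcSigma ξ s) _ _ fun r _ => ?_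
  have hm : Measurable[arcSigma ξ s]
      (fun ω (i : s) => position ((r : ℝ) / (2 ^ k : ℕ)) (ξ i ω)) :=
    @measurable_pi_lambda _ _ _ (_) _ _ fun i =>
      (measurable_position_right _).comp (measurable_arcSigma (ξ := ξ) (s := (s : Set ℕ)) i.2)
  exact hm (isClosed_exists_avoiding fun i : s => ℓ i).measurableSet

lemma exposed_anti {Ω : Type*} (ξ : ℕ → Ω → Path) (ℓ : ℕ → ℝ) {s t : Finset ℕ} (hst : s ⊆ t) :
    exposed ξ ℓ t ⊆ exposed ξ ℓ s := by
  rintro ω ⟨k, r, hr, x, hx⟩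
  exact ⟨k, r, hr, x, Set.biInter_subset_biInter_left hst hx⟩

/-- Dyadic times suffice: finitely many right-continuous step paths are constant on a common
interval to the right of `t`, and dyadic numbers approach `t` from the right. -/
lemma mem_exposed_of_mem_Icc {Ω : Type*} {ξ : ℕ → Ω → Path} {ℓ : ℕ → ℝ} {s : Finset ℕ} {ω : Ω}
    (hreg : ∀ i, Regular (ξ i ω).2) {t : ℝ} (ht : t ∈ Set.Icc (0 : ℝ) 1) {x : Circ}
    (hx : ω ∈ missedAt ξ ℓ s x t) : ω ∈ exposed ξ ℓ s := by
  have hev : ∀ᶠ v in nhdsWithin t (Set.Ici t), ∀ i ∈ s,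
      updateCount v (ξ i ω).2 = updateCount t (ξ i ω).2 := by
    rw [Filter.eventually_all_finset]
    intro i _
    obtain ⟨ε, hε, h⟩ := (hreg i).exists_updateCount_eq_right ht.1
    exact mem_of_superset (Ico_mem_nhdsGE (by linarith)) h
  have hlim : Tendsto (fun k : ℕ => ((⌈t * (2 ^ k : ℕ)⌉₊ : ℕ) : ℝ) / (2 ^ k : ℕ)) atTop
      (nhdsWithin t (Set.Ici t)) := by
    have hp : Tendsto (fun k : ℕ => ((2 ^ k : ℕ) : ℝ)) atTop atTop :=
      tendsto_natCast_atTop_atTop.comp (tendsto_pow_atTop_atTop_of_one_lt one_lt_two)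
    refine tendsto_nhdsWithin_iff.2 ⟨(tendsto_nat_ceil_mul_div_atTop ht.1).comp hp,
      Eventually.of_forall fun k => ?_⟩
    rw [Set.mem_Ici, le_div_iff₀ (by positivity)]
    exact Nat.le_ceil _
  obtain ⟨k, hk⟩ := (hlim.eventually hev).exists
  refine ⟨k, ⌈t * (2 ^ k : ℕ)⌉₊, Nat.ceil_le.2 (mul_le_of_le_one_left (by positivity) ht.2), x, ?_⟩
  simp only [missedAt, Set.mem_iInter, Set.mem_preimage, Set.mem_ofPred_eq] at hx ⊢
  intro i hi
  have := hx i hi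
  rwa [position, ← hk i hi] at this

/-! ### Almost sure covering at all times -/

lemma exists_grid_point_near (x : Circ) {Q : ℕ} (hQ : 0 < Q) :
    ∃ q ∈ Finset.range (Q + 1), ‖x - (((q : ℝ) / Q : ℝ) : Circ)‖ ≤ (1 / Q : ℝ) / 2 := by
  have hQ' : (0 : ℝ) < Q := by exact_mod_cast hQ
  induction x using QuotientAddGroup.induction_on with
  | H r =>
    have hr : ((r : ℝ) : Circ) = ((Int.fract r : ℝ) : Circ) := by
      rw [← sub_eq_zero, ← AddCircle.coe_sub, AddCircle.coe_eq_zero_iff]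
      exact ⟨⌊r⌋, by rw [zsmul_eq_mul, mul_one]; linarith [Int.floor_add_fract r]⟩
    have h0 := Int.fract_nonneg r
    have h1 := (Int.fract_lt_one r).le
    set f := Int.fract r
    -- The integer nearest to `f * Q`. It may equal `Q`, hence the `Q + 1` grid indices.
    refine ⟨⌊f * Q + 1 / 2⌋₊, ?_, ?_⟩
    · have h2 : ⌊f * Q + 1 / 2⌋₊ ≤ ⌊(Q : ℝ) + 1 / 2⌋₊ := by
        gcongr
        nlinarith
      have h3 : ⌊(Q : ℝ) + 1 / 2⌋₊ < Q + 1 := by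
        rw [Nat.floor_lt (by positivity)]
        push_cast
        linarith
      rw [Finset.mem_range]
      omega
    · change ‖((r : ℝ) : Circ) - _‖ ≤ _
      rw [hr, ← AddCircle.coe_sub]
      refine (QuotientAddGroup.norm_mk_le_norm).trans ?_
      have h4 := Nat.floor_le (a := f * Q + 1 / 2) (by positivity)
      have h5 := Nat.lt_floor_add_one (f * Q + 1 / 2)
      have h6 : |f * Q - (⌊f * Q + 1 / 2⌋₊ : ℝ)| ≤ 1 / 2 := abs_le.2 ⟨by linarith, by linarith⟩
      have h7 : f - (⌊f * Q + 1 / 2⌋₊ : ℝ) / Q = (f * Q - (⌊f * Q + 1 / 2⌋₊ : ℝ)) / Q := by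
        field_simp
      rw [Real.norm_eq_abs, h7, abs_div, abs_of_pos hQ', div_right_comm]
      gcongr

/-- Shortening the arcs by `δ` transfers "missed" from an arbitrary point to a nearby grid point, so
that finitely many points control the circle. -/
lemma mem_avoiding_of_near {x x' c : Circ} {a δ : ℝ} (hx : ‖x - x'‖ ≤ δ / 2)
    (hc : c ∈ avoiding x a) : c ∈ avoiding x' (a - δ) := by
  have h1 : a / 2 ≤ ‖x - c‖ := hc
  have h2 : ‖x - c‖ ≤ ‖x - x'‖ + ‖x' - c‖ := norm_sub_le_norm_sub_add_norm_sub x x' c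
  change (a - δ) / 2 ≤ ‖x' - c‖
  linarith

lemma missedSometime_of_mem_missedAt {Ω : Type*} {ξ : ℕ → Ω → Path} {ℓ : ℕ → ℝ} {s : Finset ℕ}
    {x x' : Circ} {δ : ℝ} (hx : ‖x - x'‖ ≤ δ / 2) {k r : ℕ} (hr : r ≤ 2 ^ k) {ω : Ω}
    (hω : ω ∈ missedAt ξ ℓ s x ((r : ℝ) / (2 ^ k : ℕ))) :
    ω ∈ missedSometime ξ (fun i => ℓ i - δ) s x' := by
  refine Set.mem_iUnion.2 ⟨k, Set.mem_biUnion (Finset.mem_range.2 (Nat.lt_succ_of_le hr)) ?_⟩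
  simp only [missedAt, Set.mem_iInter, Set.mem_preimage, Set.mem_ofPred_eq] at hω ⊢
  exact fun i hi => mem_avoiding_of_near hx (hω i hi)

namespace IsArcSystem

variable {Ω : Type*} [MeasurableSpace Ω] {P : Measure Ω} [IsProbabilityMeasure P]
  {ξ : ℕ → Ω → Path}

open Classical in
/-- Given the arcs before `n`, with positive probability all the points that are uncovered at some
time are covered by the arcs between `n` and `N`. -/
lemma measureReal_exposed_step (h : IsArcSystem P ξ) {ℓ : ℕ → ℝ} {m n N K R : ℕ} (hmn : m ≤ n) (hn : n ≤ N)
    (hK : 0 < K) (hKR : n + K * R ≤ N) {T : Finset ℕ} {z : ℕ → Circ} {δ : ℝ}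
    (hT : ∀ x : Circ, ∃ q ∈ T, ‖x - z q‖ ≤ δ / 2) {p c D : ℝ}
    (hp : ∀ q, ∀ i < N, p ≤ pathLaw.real (permanentCover (z q) (ℓ i - δ)))
    (hc0 : 0 ≤ c) (hc : c ≤ 1 - (1 - p) ^ R) (hc1 : c ≤ 1)
    (hD : ∑ q ∈ T, P.real (missedSometime ξ (fun i => ℓ i - δ) (Finset.Ico m n) (z q)) ≤ D) :
    P.real (exposed ξ ℓ (Finset.Ico m N)) ≤ P.real (exposed ξ ℓ (Finset.Ico m n)) -
      c ^ K * (P.real (exposed ξ ℓ (Finset.Ico m n)) - D / K) := by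
  set bad : ℕ → Set Ω := fun q => missedSometime ξ (fun i => ℓ i - δ) (Finset.Ico m n) (z q) with hbad
  set A := exposed ξ ℓ (Finset.Ico m n) with hA
  set A' := exposed ξ ℓ (Finset.Ico m N) with hA'
  -- Partition by the exact set `B` of bad grid points. These events depend only on the arcs in `[m,
  -- n)`, so the later arcs can be handled for each fixed `B` by independence.
  set E : Finset ℕ → Set Ω := fun B => {ω | T.filter (fun q => ω ∈ bad q) = B} with hE
  have hσle : arcSigma ξ (Finset.Ico m n : Finset ℕ) ≤ ‹MeasurableSpace Ω› := h.arcSigma_le _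
  have hbadm : ∀ q, MeasurableSet[arcSigma ξ (Finset.Ico m n : Finset ℕ)] (bad q) := fun q => measurableSet_missedSometime _ _ _ _
  have hEm : ∀ B ∈ T.powerset, MeasurableSet[arcSigma ξ (Finset.Ico m n : Finset ℕ)] (E B) := by
    intro B hB
    have : E B = ⋂ q ∈ T, if q ∈ B then bad q else (bad q)ᶜ := by
      ext ω
      simp only [hE, Set.mem_ofPred_eq, Set.mem_iInter, Finset.ext_iff, Finset.mem_filter]
      constructor
      · intro h1 q hq
        split_ifs with hqB
        · exact ((h1 q).2 hqB).2
        · exact fun h2 => hqB ((h1 q).1 ⟨hq, h2⟩)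
      · intro h1 q
        constructor
        · rintro ⟨h2, h3⟩
          by_contra hqB
          have := h1 q h2
          rw [if_neg hqB] at this
          exact this h3
        · intro hqB
          have hqT := Finset.mem_powerset.1 hB hqB
          have := h1 q hqT
          rw [if_pos hqB] at this
          exact ⟨hqT, this⟩
    rw [this]
    refine @Finset.measurableSet_biInter _ _ (arcSigma ξ (Finset.Ico m n : Finset ℕ)) _ T fun q _ => ?_
    split_ifs
    · exact hbadm q
    · exact (hbadm q).compl
  have hpart : ∀ S : Set Ω, MeasurableSet S → P.real S = ∑ B ∈ T.powerset, P.real (S ∩ E B) := by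
    intro S hS
    rw [← measureReal_biUnion_finset]
    · congr 1
      ext ω
      simp [hE]
    · intro B _ B' _ hBB
      exact Set.disjoint_left.2 fun ω h1 h2 => hBB (h1.2.symm.trans h2.2)
    · exact fun B hB => hS.inter (hσle _ (hEm B hB))
  have hAm : MeasurableSet[arcSigma ξ (Finset.Ico m n : Finset ℕ)] A := measurableSet_exposed ξ ℓ _
  have hA'm : MeasurableSet A' := h.arcSigma_le _ _ (measurableSet_exposed ξ ℓ _)
  have hstep : ∀ B ∈ T.powerset, B.card ≤ K →
      P.real (A' ∩ E B) ≤ (1 - c ^ K) * P.real (A ∩ E B) := by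
    intro B hB hBK
    set killed : Set Ω := ⋂ q ∈ B, ⋃ i ∈ Finset.Ico n (n + B.card * R),
      ξ i ⁻¹' permanentCover (z q) (ℓ i - δ) with hkilled
    have hle : n + B.card * R ≤ N := (by gcongr : n + B.card * R ≤ n + K * R).trans hKR
    have hkm : MeasurableSet[arcSigma ξ (Set.Ici n)] killed := by
      refine @Finset.measurableSet_biInter _ _ (arcSigma ξ _) _ _ fun q _ => ?_
      refine @Finset.measurableSet_biUnion _ _ (arcSigma ξ _) _ _ fun i hi => ?_
      exact measurable_arcSigma (ξ := ξ) (s := Set.Ici n) (Finset.mem_Ico.1 hi).1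
        (measurableSet_permanentCover _ _)
    have hkm' := h.arcSigma_le _ _ hkm
    have hkp : c ^ K ≤ P.real killed := by
      refine le_trans ?_ (h.measureReal_biInter_biUnion_ge
        (G := fun q i => permanentCover (z q) (ℓ i - δ))
        (fun q i => measurableSet_permanentCover _ _) hp B n hle (hc0.trans hc))
      calc c ^ K ≤ c ^ B.card := pow_le_pow_of_le_one hc0 hc1 hBK
        _ ≤ _ := pow_le_pow_left₀ hc0 hc _
    -- An uncovered `x` lies near a grid point `q`, which is then bad and so belongs to `B`. If all
    -- of `B` is killed, some shortened arc covers `z q` throughout `[0, 1]`, and the full arc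
    -- covers `x`.
    have hsub : (A' ∩ E B : Set Ω) ≤ᵐ[P] ((A ∩ E B) ∩ killedᶜ : Set Ω) := by
      filter_upwards [h.ae_regular] with ω hreg
      rintro ⟨hω, hωB⟩
      refine ⟨⟨exposed_anti ξ ℓ (Finset.Ico_subset_Ico_right hn) hω, hωB⟩, fun hk => ?_⟩
      obtain ⟨k, r, hr, x, hx⟩ := hω
      obtain ⟨q, hqT, hq⟩ := hT x
      have hqB : q ∈ B := by
        have hωB' : T.filter (fun q => ω ∈ bad q) = B := hωB
        rw [← hωB', Finset.mem_filter]
        exact ⟨hqT, missedSometime_of_mem_missedAt hq hr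
          (Set.biInter_subset_biInter_left (Finset.Ico_subset_Ico_right hn) hx)⟩
      have hk2 := Set.mem_iInter₂.1 hk q hqB
      obtain ⟨i, hi, hik⟩ := Set.mem_iUnion₂.1 hk2
      rw [Finset.mem_Ico] at hi
      have ht : ((r : ℝ) / (2 ^ k : ℕ)) ∈ Set.Icc (0 : ℝ) 1 :=
        ⟨by positivity, div_le_one_of_le₀ (by exact_mod_cast hr) (by positivity)⟩
      have hball := position_mem_ball_of_mem_permanentCover (hreg i) hik ht
      have hmiss : position ((r : ℝ) / (2 ^ k : ℕ)) (ξ i ω) ∈ avoiding x (ℓ i) := by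
        exact Set.mem_iInter₂.1 hx i (Finset.mem_Ico.2 ⟨hmn.trans hi.1, by omega⟩)
      have := mem_avoiding_of_near hq hmiss
      rw [avoiding_eq_compl_ball] at this
      exact this hball
    have hdisj : Disjoint ((Finset.Ico m n : Finset ℕ) : Set ℕ) (Set.Ici n) := by
      rw [Set.disjoint_left]
      intro i hi hi'
      rw [Finset.coe_Ico] at hi
      exact absurd hi.2 (not_lt.2 hi')
    calc P.real (A' ∩ E B) ≤ P.real ((A ∩ E B) ∩ killedᶜ) :=
          ENNReal.toReal_mono (measure_ne_top P _) (measure_mono_ae hsub)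
      _ = P.real (A ∩ E B) * P.real killedᶜ :=
          h.measureReal_inter_of_disjoint hdisj (@MeasurableSet.inter _ (_) _ _ hAm (hEm B hB)) hkm.compl
      _ ≤ P.real (A ∩ E B) * (1 - c ^ K) := by
          refine mul_le_mul_of_nonneg_left ?_ measureReal_nonneg
          rw [measureReal_compl hkm', probReal_univ]
          linarith
      _ = _ := mul_comm _ _
  have hbadsum : ∀ q ∈ T, P.real (bad q) = ∑ B ∈ T.powerset, if q ∈ B then P.real (E B) else 0 := by
    intro q hq
    rw [hpart _ (hσle _ (hbadm q))]
    refine Finset.sum_congr rfl fun B _ => ?_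
    split_ifs with hqB
    · congr 1
      refine Set.inter_eq_right.2 fun ω hω => ?_
      have hω' : T.filter (fun q => ω ∈ bad q) = B := hω
      rw [← hω', Finset.mem_filter] at hqB
      exact hqB.2
    · have : bad q ∩ E B = ∅ := by
        rw [Set.eq_empty_iff_forall_notMem]
        rintro ω ⟨h1, h2⟩
        have hω' : T.filter (fun q => ω ∈ bad q) = B := h2
        exact hqB (hω' ▸ Finset.mem_filter.2 ⟨hq, h1⟩)
      rw [this, measureReal_empty]
  -- The left side is the expected number of bad grid points.
  have hcard : ∑ B ∈ T.powerset, (B.card : ℝ) * P.real (E B) ≤ D := by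
    refine le_trans (le_of_eq ?_) hD
    rw [Finset.sum_congr rfl hbadsum, Finset.sum_comm]
    refine Finset.sum_congr rfl fun B hB => ?_
    rw [← Finset.sum_filter, Finset.filter_mem_eq_inter,
      Finset.inter_eq_right.2 (Finset.mem_powerset.1 hB), Finset.sum_const, nsmul_eq_mul]
  have hK' : (0 : ℝ) < K := by exact_mod_cast hK
  -- Markov's inequality: more than `K` bad points occur with probability at most `D / K`.
  have hbig : ∑ B ∈ T.powerset, (if B.card ≤ K then 0 else P.real (A ∩ E B)) ≤ D / K := by
    rw [le_div_iff₀ hK', Finset.sum_mul]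
    refine le_trans (Finset.sum_le_sum fun B _ => ?_) hcard
    split_ifs with hBK
    · rw [zero_mul]
      positivity
    · rw [mul_comm]
      have : (K : ℝ) ≤ B.card := by exact_mod_cast (not_le.1 hBK).le
      exact mul_le_mul this (measureReal_mono Set.inter_subset_right) measureReal_nonneg (by positivity)
  have hcK : 0 ≤ c ^ K := pow_nonneg hc0 K
  have hfin : P.real A' ≤ P.real A - c ^ K *
      (P.real A - ∑ B ∈ T.powerset, (if B.card ≤ K then 0 else P.real (A ∩ E B))) := by
    rw [hpart A' hA'm, hpart A (hσle _ hAm), ← Finset.sum_sub_distrib, Finset.mul_sum,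
      ← Finset.sum_sub_distrib]
    refine Finset.sum_le_sum fun B hB => ?_
    split_ifs with hBK
    · have := hstep B hB hBK
      linarith
    · have : P.real (A' ∩ E B) ≤ P.real (A ∩ E B) := measureReal_mono
        (Set.inter_subset_inter_left _ (exposed_anti ξ ℓ (Finset.Ico_subset_Ico_right hn)))
      simpa using this
  have := mul_le_mul_of_nonneg_left hbig hcK
  linarith

end IsArcSystem

/-! ### Explicit estimates at scale `n` and passage to the limit -/

lemma sum_range_inv_le_log (n : ℕ) :
    ∑ i ∈ Finset.range n, 1 / ((i : ℝ) + 1) ≤ 1 + Real.log n := by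
  have := harmonic_le_one_add_log n
  simpa [harmonic] using this

/-- Since `1 - ℓ_i ≥ 1/2`, each shortened factor is at most `(1 - ℓ_i)(1 + 2δ)`, and omitting the
first `m` factors costs at most `2^m`. -/
lemma prod_one_sub_add_le {ℓ : ℕ → ℝ} (hhalf : ∀ i, ℓ i ≤ 1 / 2) {δ : ℝ}
    (hδ : 0 ≤ δ) {m n : ℕ} (hmn : m ≤ n) :
    ∏ i ∈ Finset.Ico m n, (1 - (ℓ i - δ)) ≤ 2 ^ m * u ℓ n * Real.exp (2 * δ * n) := by
  have h1 : ∏ i ∈ Finset.Ico m n, (1 - (ℓ i - δ)) ≤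
      ∏ i ∈ Finset.Ico m n, ((1 - ℓ i) * Real.exp (2 * δ)) := by
    refine Finset.prod_le_prod (fun i _ => by linarith [hhalf i]) fun i _ => ?_
    have := Real.add_one_le_exp (2 * δ)
    nlinarith [mul_le_mul_of_nonneg_left this (by linarith [hhalf i] : 0 ≤ 1 - ℓ i), hhalf i]
  have h2 : (1 / 2 : ℝ) ^ m ≤ u ℓ m := by
    rw [u, ← Finset.card_range m, ← Finset.prod_const, Finset.card_range]
    exact Finset.prod_le_prod (fun _ _ => by norm_num) fun i _ => by linarith [hhalf i]
  have h3 : u ℓ m * ∏ i ∈ Finset.Ico m n, (1 - ℓ i) = u ℓ n :=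
    Finset.prod_range_mul_prod_Ico _ hmn
  have h4 : 0 ≤ ∏ i ∈ Finset.Ico m n, (1 - ℓ i) :=
    Finset.prod_nonneg fun i _ => by linarith [hhalf i]
  have h5 : ∏ i ∈ Finset.Ico m n, (1 - ℓ i) ≤ 2 ^ m * u ℓ n := by
    rw [← h3]
    calc ∏ i ∈ Finset.Ico m n, (1 - ℓ i)
        = 2 ^ m * ((1 / 2 : ℝ) ^ m * ∏ i ∈ Finset.Ico m n, (1 - ℓ i)) := by
          rw [← mul_assoc, ← mul_pow]
          norm_num
      _ ≤ _ := by gcongr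
  refine h1.trans ?_
  rw [Finset.prod_mul_distrib, Finset.prod_const, Nat.card_Ico, ← Real.exp_nat_mul]
  refine mul_le_mul h5 (Real.exp_le_exp.2 ?_) (Real.exp_pos _).le (h4.trans h5)
  have : ((n - m : ℕ) : ℝ) ≤ n := by exact_mod_cast Nat.sub_le n m
  nlinarith

lemma u_nonneg {ℓ : ℕ → ℝ} (hhalf : ∀ i, ℓ i ≤ 1 / 2) (n : ℕ) : 0 ≤ u ℓ n :=
  Finset.prod_nonneg fun i _ => by linarith [hhalf i]

namespace IsArcSystem

variable {Ω : Type*} [MeasurableSpace Ω] {P : Measure Ω} [IsProbabilityMeasure P]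
  {ξ : ℕ → Ω → Path}

/-- The step estimate at scale `n`, with explicit constants. -/
lemma measureReal_exposed_two_mul_le (h : IsArcSystem P ξ) {ℓ : ℕ → ℝ} {M₀ M₁ : ℝ} (hM₀ : 0 < M₀)
    (hlow : ∀ n : ℕ, M₀ / ((n : ℝ) + 1) ≤ ℓ n) (hup : ∀ n : ℕ, ℓ n ≤ M₁ / ((n : ℝ) + 1))
    (hhalf : ∀ i, ℓ i ≤ 1 / 2) {m n K : ℕ} (hmn : m ≤ n) (hn3 : 3 ≤ n) (hK : 0 < K) (hKn : K ≤ n) :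
    P.real (exposed ξ ℓ (Finset.Ico m (2 * n))) ≤ P.real (exposed ξ ℓ (Finset.Ico m n)) -
      (1 - Real.exp (-(M₀ * Real.exp (-1) / (8 * K)))) ^ K *
        (P.real (exposed ξ ℓ (Finset.Ico m n)) -
          ((4 / M₀ + 2) * 2 ^ m * Real.exp M₀ * (1 + 2 * M₁) * (n * Real.log n * u ℓ n)) / K) := by
  have hn0 : (0 : ℝ) < n := by exact_mod_cast (by omega : 0 < n)
  have hK0 : (0 : ℝ) < K := by exact_mod_cast hK
  have hM₁ : 0 < M₁ := by
    have := (hlow 0).trans (hup 0)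
    simp at this
    linarith
  -- The mesh `1/Q ≤ M₀/(4n)` is at most half of `M₀/(2n)`, a lower bound for the first `2n`
  -- lengths; shortened arcs keep length at least `M₀/(4n)`.
  set Q : ℕ := ⌈4 * n / M₀⌉₊ with hQ
  have hQ1 : 4 * n / M₀ ≤ (Q : ℝ) := Nat.le_ceil _
  have hQ0 : (0 : ℝ) < Q := lt_of_lt_of_le (by positivity) hQ1
  have hQ2 : (Q : ℝ) < 4 * n / M₀ + 1 := Nat.ceil_lt_add_one (by positivity)
  set δ : ℝ := 1 / Q with hδ
  have hδ0 : 0 < δ := by positivity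
  have hδ1 : δ ≤ M₀ / (4 * n) := by
    rw [hδ, div_le_div_iff₀ hQ0 (by positivity)]
    rw [div_le_iff₀ hM₀] at hQ1
    linarith
  have hb : ∀ i < 2 * n, M₀ / (4 * n) ≤ ℓ i - δ := by
    intro i hi
    have h1 : M₀ / (2 * n) ≤ ℓ i := by
      refine le_trans ?_ (hlow i)
      gcongr
      exact_mod_cast (by omega : i + 1 ≤ 2 * n)
    have h2 : M₀ / (2 * n) = M₀ / (4 * n) + M₀ / (4 * n) := by
      field_simp
      ring
    linarith
  have hb0 : ∀ i < 2 * n, 0 ≤ ℓ i - δ := fun i hi => le_trans (by positivity) (hb i hi)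
  have hb1 : ∀ i, ℓ i - δ ≤ 1 := fun i => by linarith [hhalf i]
  set p : ℝ := M₀ / (4 * n) * Real.exp (-1) with hp
  -- `K` blocks of `R` arcs fit into `[n, 2n)`. Since `R ≥ n/(2K)`, the product `R p` is bounded
  -- below independently of `n`.
  set R : ℕ := n / K with hR
  have hpp : ∀ (x : Circ), ∀ i < 2 * n, p ≤ pathLaw.real (permanentCover x (ℓ i - δ)) := by
    intro x i hi
    rw [pathLaw_permanentCover x (hb0 i hi) (hb1 i)]
    exact mul_le_mul_of_nonneg_right (hb i hi) (Real.exp_pos _).le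
  have hp1 : p ≤ 1 := (hpp 0 0 (by omega)).trans measureReal_le_one
  have hR2 : (n : ℝ) / (2 * K) ≤ R := by
    have h1 : n < K * (R + 1) := Nat.lt_mul_div_succ n hK
    have h2 : 1 ≤ R := (Nat.one_le_div_iff hK).2 hKn
    have h3 : n ≤ K * (2 * R) := h1.le.trans (Nat.mul_le_mul_left _ (by omega))
    rw [div_le_iff₀ (by positivity)]
    have : (n : ℝ) ≤ K * (2 * R) := by exact_mod_cast h3
    linarith
  have hc : 1 - Real.exp (-(M₀ * Real.exp (-1) / (8 * K))) ≤ 1 - (1 - p) ^ R := by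
    have h1 : (1 - p) ^ R ≤ Real.exp (-p) ^ R :=
      pow_le_pow_left₀ (by linarith) (by linarith [Real.add_one_le_exp (-p)]) _
    have h2 : Real.exp (-p) ^ R ≤ Real.exp (-(M₀ * Real.exp (-1) / (8 * K))) := by
      rw [← Real.exp_nat_mul]
      refine Real.exp_le_exp.2 ?_
      have h3 : M₀ * Real.exp (-1) / (8 * K) = n / (2 * K) * p := by
        rw [hp]
        field_simp
        ring
      have h4 : n / (2 * K) * p ≤ R * p := mul_le_mul_of_nonneg_right hR2 (by positivity)
      rw [h3]
      linarith
    linarith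
  have hDsum : ∑ q ∈ Finset.range (Q + 1), P.real (missedSometime ξ (fun i => ℓ i - δ)
      (Finset.Ico m n) (((q : ℝ) / Q : ℝ) : Circ)) ≤
      (4 / M₀ + 2) * 2 ^ m * Real.exp M₀ * (1 + 2 * M₁) * (n * Real.log n * u ℓ n) := by
    -- From `n ≥ 3 > e`; this absorbs the additive constants into `log n`.
    have hlog : 1 ≤ Real.log n := by
      rw [Real.le_log_iff_exp_le hn0]
      have : (3 : ℝ) ≤ n := by exact_mod_cast hn3
      linarith [Real.exp_one_lt_d9]
    have hS : 1 + ∑ i ∈ Finset.Ico m n, (ℓ i - δ) ≤ (1 + 2 * M₁) * Real.log n := by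
      have h1 : ∑ i ∈ Finset.Ico m n, (ℓ i - δ) ≤ ∑ i ∈ Finset.range n, M₁ * (1 / ((i : ℝ) + 1)) := by
        calc ∑ i ∈ Finset.Ico m n, (ℓ i - δ) ≤ ∑ i ∈ Finset.Ico m n, M₁ * (1 / ((i : ℝ) + 1)) := by
              refine Finset.sum_le_sum fun i _ => ?_
              have := hup i
              rw [mul_one_div]
              linarith
          _ ≤ _ := Finset.sum_le_sum_of_subset_of_nonneg
              (fun i hi => Finset.mem_range.2 (Finset.mem_Ico.1 hi).2) fun _ _ _ => by positivity
      rw [← Finset.mul_sum] at h1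
      have h2 := mul_le_mul_of_nonneg_left (sum_range_inv_le_log n) hM₁.le
      nlinarith
    have hS0 : 0 ≤ 1 + ∑ i ∈ Finset.Ico m n, (ℓ i - δ) := by
      have : 0 ≤ ∑ i ∈ Finset.Ico m n, (ℓ i - δ) := Finset.sum_nonneg fun i hi =>
        hb0 i (by have := (Finset.mem_Ico.1 hi).2; omega)
      linarith
    have hU := prod_one_sub_add_le hhalf hδ0.le hmn
    have hexp : Real.exp (2 * δ * n) ≤ Real.exp M₀ := by
      refine Real.exp_le_exp.2 ?_
      have h1 : 2 * δ * n ≤ 2 * (M₀ / (4 * n)) * n := by gcongr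
      have h2 : 2 * (M₀ / (4 * n)) * n = M₀ / 2 := by field_simp; ring
      linarith
    have hu := u_nonneg hhalf n
    have hterm : ∀ q ∈ Finset.range (Q + 1), P.real (missedSometime ξ (fun i => ℓ i - δ)
        (Finset.Ico m n) (((q : ℝ) / Q : ℝ) : Circ)) ≤
        (2 ^ m * u ℓ n * Real.exp M₀) * ((1 + 2 * M₁) * Real.log n) := by
      intro q _
      refine (h.measureReal_missedSometime_le
        (fun i hi => hb0 i (by have := (Finset.mem_Ico.1 hi).2; omega)) (fun i _ => hb1 i) _).trans ?_
      exact mul_le_mul (hU.trans (by gcongr)) hS hS0 (by positivity)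
    refine (Finset.sum_le_sum hterm).trans ?_
    rw [Finset.sum_const, Finset.card_range, nsmul_eq_mul]
    have hQn : ((Q + 1 : ℕ) : ℝ) ≤ (4 / M₀ + 2) * n := by
      push_cast
      have h1 : (4 / M₀ + 2) * n = 4 * n / M₀ + 2 * n := by ring
      have : (3 : ℝ) ≤ n := by exact_mod_cast hn3
      linarith
    calc ((Q + 1 : ℕ) : ℝ) * ((2 ^ m * u ℓ n * Real.exp M₀) * ((1 + 2 * M₁) * Real.log n))
        ≤ ((4 / M₀ + 2) * n) * ((2 ^ m * u ℓ n * Real.exp M₀) * ((1 + 2 * M₁) * Real.log n)) := by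
          gcongr
      _ = _ := by ring
  have hKR : n + K * R ≤ 2 * n := by
    have : K * R ≤ n := Nat.mul_div_le n K
    omega
  have hpos : 0 ≤ M₀ * Real.exp (-1) / (8 * K) := by positivity
  have hle1 : Real.exp (-(M₀ * Real.exp (-1) / (8 * K))) ≤ 1 :=
    Real.exp_le_one_iff.2 (by linarith)
  exact h.measureReal_exposed_step hmn (by omega) hK hKR
    (fun x => exists_grid_point_near x (by exact_mod_cast hQ0))
    (fun q i hi => hpp _ i hi) (by linarith) hc
    (by linarith [Real.exp_pos (-(M₀ * Real.exp (-1) / (8 * K)))]) hDsum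

/-- The probabilities decrease to some `L`. If `L > 0`, then at a large good scale `n` the step from
`n` to `2n` lowers the probability by at least `c^K L/2`, with `c` and `K` independent of `n`, which
takes it below `L`. -/
lemma tendsto_measureReal_exposed (h : IsArcSystem P ξ) {ℓ : ℕ → ℝ} {M₀ M₁ : ℝ} (hM₀ : 0 < M₀)
    (hlow : ∀ n : ℕ, M₀ / ((n : ℝ) + 1) ≤ ℓ n) (hup : ∀ n : ℕ, ℓ n ≤ M₁ / ((n : ℝ) + 1))
    (hhalf : ∀ i, ℓ i ≤ 1 / 2) {D : ℝ} (hD : ∃ᶠ n : ℕ in atTop, n * Real.log n * u ℓ n ≤ D) (m : ℕ) :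
    Tendsto (fun n => P.real (exposed ξ ℓ (Finset.Ico m n))) atTop (nhds 0) := by
  set a : ℕ → ℝ := fun n => P.real (exposed ξ ℓ (Finset.Ico m n)) with ha
  have hanti : Antitone a := fun n n' hn =>
    measureReal_mono (exposed_anti ξ ℓ (Finset.Ico_subset_Ico_right hn))
  have hbdd : BddBelow (Set.range a) := ⟨0, by rintro _ ⟨n, rfl⟩; exact measureReal_nonneg⟩
  have hlim := tendsto_atTop_ciInf hanti hbdd
  set L := ⨅ n, a n with hL
  have hLle : ∀ n, L ≤ a n := fun n => ciInf_le hbdd n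
  have hL0 : 0 ≤ L := le_ciInf fun n => measureReal_nonneg
  rcases hL0.eq_or_lt with h0 | hLpos
  · rwa [← h0] at hlim
  exfalso
  have hM₁ : 0 < M₁ := by
    have := (hlow 0).trans (hup 0)
    simp at this
    linarith
  set c₁ := (4 / M₀ + 2) * 2 ^ m * Real.exp M₀ * (1 + 2 * M₁) with hc₁
  have hc₁0 : 0 < c₁ := by positivity
  -- Large enough for the Markov error `c₁ D / K` to be at most `L / 2`; the `+ 1` keeps `K`
  -- positive.
  set K : ℕ := ⌈2 * (c₁ * D) / L⌉₊ + 1 with hK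
  have hK0 : (0 : ℝ) < K := by positivity
  have hK1 : c₁ * D / K ≤ L / 2 := by
    have h1 : 2 * (c₁ * D) / L ≤ K := (Nat.le_ceil _).trans (by rw [hK]; push_cast; linarith)
    rw [div_le_iff₀ hLpos] at h1
    rw [div_le_iff₀ hK0]
    linarith
  set c := 1 - Real.exp (-(M₀ * Real.exp (-1) / (8 * K))) with hc
  have hcpos : 0 < c := by
    have : Real.exp (-(M₀ * Real.exp (-1) / (8 * K))) < 1 := by
      rw [Real.exp_lt_one_iff]
      have : 0 < M₀ * Real.exp (-1) / (8 * K) := by positivity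
      linarith
    linarith
  have hcK : 0 < c ^ K := by positivity
  have hev : ∀ᶠ n in atTop, a n < L + c ^ K * (L / 2) :=
    hlim.eventually_lt_const (by linarith [mul_pos hcK (half_pos hLpos)])
  obtain ⟨n, hnD, hna, hnm, hn3, hnK⟩ := (hD.and_eventually (hev.and ((eventually_ge_atTop m).and
    ((eventually_ge_atTop 3).and (eventually_ge_atTop K))))).exists
  have hstep := h.measureReal_exposed_two_mul_le hM₀ hlow hup hhalf hnm hn3 (by omega : 0 < K) hnK
  have h1 : c₁ * (n * Real.log n * u ℓ n) / K ≤ L / 2 := by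
    refine le_trans ?_ hK1
    gcongr
  have h2 : L / 2 ≤ a n - c₁ * (n * Real.log n * u ℓ n) / K := by linarith [hLle n]
  have h3 := mul_le_mul_of_nonneg_left h2 hcK.le
  have h4 := hLle (2 * n)
  have h5 : a (2 * n) ≤ a n - c ^ K * (a n - c₁ * (n * Real.log n * u ℓ n) / K) := hstep
  linarith

end IsArcSystem

lemma mem_uncoveredSet_iff {Ω : Type*} {ℓ : ℕ → ℝ} {C : ℕ → ℕ → Ω → Circ} {Y : ℕ → ℕ → Ω → ℝ}
    {ω : Ω} (hreg : ∀ i, Regular (inputPath C Y i ω).2) {t : ℝ} (ht : 0 ≤ t) {x : Circ} :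
    x ∈ uncoveredSet ℓ C Y t ω ↔
      ∃ m, ∀ i ≥ m, position t (inputPath C Y i ω) ∈ avoiding x (ℓ i) := by
  rw [uncoveredSet, coveredSet, Set.mem_compl_iff, mem_limsup_iff_frequently_mem,
    not_frequently, eventually_atTop]
  simp_rw [mem_avoiding, center_eq_position C Y _ ht (hreg _)]

theorem ae_forall_uncoveredSet_eq_empty {Ω : Type*} [MeasurableSpace Ω] {P : Measure Ω}
    [IsProbabilityMeasure P] {ℓ : ℕ → ℝ} (hhalf : ∀ i, ℓ i ≤ 1 / 2) (hΘ : IsThetaInv ℓ)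
    {C : ℕ → ℕ → Ω → Circ} {Y : ℕ → ℕ → Ω → ℝ} (hmodel : IsPoissonInput P 0 ℓ C Y) {D : ℝ}
    (hD : ∃ᶠ n : ℕ in atTop, n * Real.log n * u ℓ n ≤ D) :
    ∀ᵐ ω ∂P, ¬ ∃ t ∈ Set.Icc (0 : ℝ) 1, (uncoveredSet ℓ C Y t ω).Nonempty := by
  obtain ⟨M₀, M₁, hM₀, -, hM⟩ := hΘ
  have h := hmodel.isArcSystem
  have hnull : ∀ᵐ ω ∂P, ∀ m, ¬ ∀ n, ω ∈ exposed (inputPath C Y) ℓ (Finset.Ico m n) := by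
    rw [ae_all_iff]
    intro m
    rw [ae_iff]
    simp only [not_not]
    rw [← measureReal_eq_zero_iff]
    refine le_antisymm ?_ measureReal_nonneg
    refine ge_of_tendsto' (h.tendsto_measureReal_exposed hM₀ (fun n => (hM n).1)
      (fun n => (hM n).2) hhalf hD m) fun n => measureReal_mono fun ω hω => hω n
  filter_upwards [h.ae_regular, hnull] with ω hreg hω
  rintro ⟨t, ht, x, hx⟩
  obtain ⟨m, hm⟩ := (mem_uncoveredSet_iff hreg ht.1).1 hx
  refine hω m fun n => mem_exposed_of_mem_Icc hreg ht (x := x) ?_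
  exact Set.mem_iInter₂.2 fun i hi => hm i (Finset.mem_Ico.1 hi).1

/-! ### The second moment of the uncovered set in space-time -/

lemma volume_circ_singleton (x : Circ) : volume ({x} : Set Circ) = 0 := by
  rw [← Metric.closedBall_zero, AddCircle.volume_closedBall]
  simp

/-- The uniform law on `[0, 1] × C`. -/
abbrev spaceTime : Measure (ℝ × Circ) := (volume.restrict (Set.Icc (0 : ℝ) 1)).prod volume

instance isProbabilityMeasure_unitInterval :
    IsProbabilityMeasure ((volume : Measure ℝ).restrict (Set.Icc (0 : ℝ) 1)) :=
  ⟨by simp⟩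

lemma ae_spaceTime_mem_Icc : ∀ᵐ z ∂spaceTime, z.1 ∈ Set.Icc (0 : ℝ) 1 :=
  Measure.quasiMeasurePreserving_fst.ae (ae_restrict_mem measurableSet_Icc)

lemma ae_spaceTime_ne (x : Circ) : ∀ᵐ z ∂spaceTime, z.2 ≠ x := by
  refine Measure.quasiMeasurePreserving_snd.ae (p := fun y : Circ => y ≠ x) ?_
  rw [ae_iff]
  simpa using volume_circ_singleton x

/-- The diagonal must be discarded: `scale M 0 = 0` because division by zero gives zero, so
`correlation` is no valid bound there. -/
lemma ae_spaceTime_prod_ne : ∀ᵐ q ∂(spaceTime.prod spaceTime), q.1.2 ≠ q.2.2 := by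
  have hm : MeasurableSet {q : (ℝ × Circ) × (ℝ × Circ) | q.1.2 = q.2.2} :=
    measurableSet_eq_fun measurable_fst.snd measurable_snd.snd
  rw [ae_iff]
  simp only [ne_eq, not_not]
  rw [Measure.measure_prod_null hm]
  refine Eventually.of_forall fun z => ?_
  have := ae_spaceTime_ne z.2
  rw [ae_iff] at this
  refine measure_mono_null (fun w hw => ?_) this
  have hw' : z.2 = w.2 := hw
  simp [hw']

/-- The proportion of `[0, 1] × C` that is uncovered by the arcs with index in `s`. -/
def missedMass {Ω : Type*} (ξ : ℕ → Ω → Path) (ℓ : ℕ → ℝ) (s : Finset ℕ) (ω : Ω) : ENNReal :=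
  spaceTime {z | ω ∈ missedAt ξ ℓ s z.2 z.1}

lemma measurableSet_missed_joint {Ω : Type*} [MeasurableSpace Ω] {ξ : ℕ → Ω → Path}
    (hξ : ∀ i, Measurable (ξ i)) (ℓ : ℕ → ℝ) (s : Finset ℕ) :
    MeasurableSet {p : Ω × (ℝ × Circ) | p.1 ∈ missedAt ξ ℓ s p.2.2 p.2.1} := by
  have : {p : Ω × (ℝ × Circ) | p.1 ∈ missedAt ξ ℓ s p.2.2 p.2.1} =
      ⋂ i ∈ s, {p : Ω × (ℝ × Circ) | ℓ i / 2 ≤ ‖p.2.2 - position p.2.1 (ξ i p.1)‖} := by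
    ext p
    simp [missedAt, avoiding]
  rw [this]
  refine Finset.measurableSet_biInter s fun i _ => measurableSet_le measurable_const ?_
  have h1 : Measurable fun p : Ω × (ℝ × Circ) => position p.2.1 (ξ i p.1) :=
    measurable_position.comp (measurable_snd.fst.prodMk ((hξ i).comp measurable_fst))
  exact (measurable_snd.snd.sub h1).norm

/-- This is `U^2 1_{Z = 0} ≤ (Z - U)^2`, expanded so that no subtraction occurs in `ENNReal`. -/
lemma two_mul_add_sq_indicator_le (U Z : ENNReal) :
    U ^ 2 * (if Z = 0 then 1 else 0) + 2 * (U * Z) ≤ U ^ 2 + Z ^ 2 := by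
  split_ifs with h
  · simp [h]
  · rw [mul_zero, zero_add]
    rcases le_total U Z with hUZ | hUZ
    · obtain ⟨d, rfl⟩ := exists_add_of_le hUZ
      calc 2 * (U * (U + d)) ≤ 2 * (U * (U + d)) + d ^ 2 := le_self_add
        _ = _ := by ring
    · obtain ⟨d, rfl⟩ := exists_add_of_le hUZ
      calc 2 * ((Z + d) * Z) ≤ 2 * ((Z + d) * Z) + d ^ 2 := le_self_add
        _ = _ := by ring

namespace IsArcSystem

variable {Ω : Type*} [MeasurableSpace Ω] {P : Measure Ω}
  {ξ : ℕ → Ω → Path}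

lemma measurable_missedMass (h : IsArcSystem P ξ) (ℓ : ℕ → ℝ) (s : Finset ℕ) :
    Measurable (missedMass ξ ℓ s) :=
  measurable_measure_prodMk_left (measurableSet_missed_joint h.measurable ℓ s)

lemma lintegral_missedMass [IsProbabilityMeasure P] (h : IsArcSystem P ξ) {ℓ : ℕ → ℝ} (h0 : ∀ i, 0 ≤ ℓ i)
    (h1 : ∀ i, ℓ i ≤ 1) (s : Finset ℕ) :
    ∫⁻ ω, missedMass ξ ℓ s ω ∂P = ENNReal.ofReal (∏ i ∈ s, (1 - ℓ i)) := by
  have hm := measurableSet_missed_joint h.measurable ℓ s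
  have : ∫⁻ ω, missedMass ξ ℓ s ω ∂P =
      (P.prod spaceTime) {p : Ω × (ℝ × Circ) | p.1 ∈ missedAt ξ ℓ s p.2.2 p.2.1} :=
    (Measure.prod_apply hm).symm
  rw [this, Measure.prod_apply_symm hm]
  have h2 : ∀ᵐ z ∂spaceTime, P ((fun ω => (ω, z)) ⁻¹'
      {p : Ω × (ℝ × Circ) | p.1 ∈ missedAt ξ ℓ s p.2.2 p.2.1}) =
      ENNReal.ofReal (∏ i ∈ s, (1 - ℓ i)) := by
    filter_upwards [ae_spaceTime_mem_Icc] with z hz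
    rw [← h.measureReal_missedAt (fun i _ => h0 i) (fun i _ => h1 i) z.2 hz.1, ofReal_measureReal]
    rfl
  rw [lintegral_congr_ae h2]
  simp

lemma measureReal_missedAt_inter_le (h : IsArcSystem P ξ) {ℓ : ℕ → ℝ} (h0 : ∀ i, 0 ≤ ℓ i)
    (hhalf : ∀ i, ℓ i ≤ 1 / 2) (s : Finset ℕ) (x x' : Circ) {t t' : ℝ} (ht : 0 ≤ t) (ht' : 0 ≤ t') :
    P.real (missedAt ξ ℓ s x t ∩ missedAt ξ ℓ s x' t') ≤ (∏ i ∈ s, (1 - ℓ i)) ^ 2 *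
      Real.exp (Real.exp (-|t - t'|) * ∑ i ∈ s, max (ℓ i - ‖x - x'‖) 0 + 6 * ∑ i ∈ s, ℓ i ^ 2) := by
  have hinter : missedAt ξ ℓ s x t ∩ missedAt ξ ℓ s x' t' =
      ⋂ i ∈ s, ξ i ⁻¹' {p | position t p ∈ avoiding x (ℓ i) ∧ position t' p ∈ avoiding x' (ℓ i)} := by
    ext ω
    simp only [missedAt, Set.mem_inter_iff, Set.mem_iInter, Set.mem_preimage, Set.mem_ofPred_eq]
    exact ⟨fun h i hi => ⟨h.1 i hi, h.2 i hi⟩, fun h => ⟨fun i hi => (h i hi).1, fun i hi => (h i hi).2⟩⟩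
  rw [hinter, h.measureReal_biInter s
    (A := fun i => {p | position t p ∈ avoiding x (ℓ i) ∧ position t' p ∈ avoiding x' (ℓ i)})
    fun i => (measurableSet_position_avoiding t x (ℓ i)).inter
      (measurableSet_position_avoiding t' x' (ℓ i)),
    Finset.mul_sum, Finset.mul_sum, ← Finset.sum_add_distrib, Real.exp_sum, ← Finset.prod_pow,
    ← Finset.prod_mul_distrib]
  exact Finset.prod_le_prod (fun i _ => measureReal_nonneg) fun i _ =>
    pathLaw_avoiding_pair_le ht ht' x x' (h0 i) (hhalf i)

lemma lintegral_missedMass_sq_le [IsProbabilityMeasure P] (h : IsArcSystem P ξ) {ℓ : ℕ → ℝ} {s : Finset ℕ}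
    {F : (ℝ × Circ) × (ℝ × Circ) → ENNReal} {U : ENNReal}
    (hF : ∀ᵐ q ∂(spaceTime.prod spaceTime),
      P (missedAt ξ ℓ s q.1.2 q.1.1 ∩ missedAt ξ ℓ s q.2.2 q.2.1) ≤ U * F q) (hU : U ≠ ⊤) :
    ∫⁻ ω, missedMass ξ ℓ s ω ^ 2 ∂P ≤ U * ∫⁻ q, F q ∂(spaceTime.prod spaceTime) := by
  have hm := measurableSet_missed_joint h.measurable ℓ s
  set W : Set (Ω × ((ℝ × Circ) × (ℝ × Circ))) := {p |
      p.1 ∈ missedAt ξ ℓ s p.2.1.2 p.2.1.1 ∧ p.1 ∈ missedAt ξ ℓ s p.2.2.2 p.2.2.1} with hW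
  have hf1 : Measurable fun p : Ω × ((ℝ × Circ) × (ℝ × Circ)) => (p.1, p.2.1) := by fun_prop
  have hf2 : Measurable fun p : Ω × ((ℝ × Circ) × (ℝ × Circ)) => (p.1, p.2.2) := by fun_prop
  have hm2 : MeasurableSet W := (hf1 hm).inter (hf2 hm)
  have h2 : ∀ ω, Prod.mk ω ⁻¹' W =
      {z | ω ∈ missedAt ξ ℓ s z.2 z.1} ×ˢ {z | ω ∈ missedAt ξ ℓ s z.2 z.1} := by
    intro ω
    ext q
    simp [hW]
  have h3 : ∀ q, (fun ω => (ω, q)) ⁻¹' W =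
      missedAt ξ ℓ s q.1.2 q.1.1 ∩ missedAt ξ ℓ s q.2.2 q.2.1 := by
    intro q
    ext ω
    simp [hW]
  have h1 : ∫⁻ ω, missedMass ξ ℓ s ω ^ 2 ∂P = (P.prod (spaceTime.prod spaceTime)) W := by
    rw [Measure.prod_apply hm2]
    refine lintegral_congr fun ω => ?_
    rw [h2, Measure.prod_prod, sq, missedMass]
  rw [h1, Measure.prod_apply_symm hm2, ← lintegral_const_mul' _ _ hU]
  simp_rw [h3]
  exact lintegral_mono_ae hF

/-- The second moment method (Chebyshev's inequality). -/
lemma measure_missedMass_eq_zero_add_one_le [IsProbabilityMeasure P] (h : IsArcSystem P ξ) {ℓ : ℕ → ℝ} (h0 : ∀ i, 0 ≤ ℓ i)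
    (hhalf : ∀ i, ℓ i ≤ 1 / 2) {s : Finset ℕ} {F : (ℝ × Circ) × (ℝ × Circ) → ℝ}
    (hF : ∀ z z' : ℝ × Circ, z.2 ≠ z'.2 →
      Real.exp (Real.exp (-|z.1 - z'.1|) * ∑ i ∈ s, max (ℓ i - ‖z.2 - z'.2‖) 0 +
        6 * ∑ i ∈ s, ℓ i ^ 2) ≤ F (z, z')) :
    P {ω | missedMass ξ ℓ s ω = 0} + 1 ≤
      ∫⁻ q, ENNReal.ofReal (F q) ∂(spaceTime.prod spaceTime) := by
  set u₀ : ℝ := ∏ i ∈ s, (1 - ℓ i) with hu₀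
  have hu₀pos : 0 < u₀ := Finset.prod_pos fun i _ => by linarith [hhalf i]
  set U := ENNReal.ofReal u₀ with hU
  have hU0 : U ^ 2 ≠ 0 := pow_ne_zero 2 (by simpa [hU] using hu₀pos)
  have hUt : U ^ 2 ≠ ⊤ := by finiteness
  have hmean : ∫⁻ ω, missedMass ξ ℓ s ω ∂P = U :=
    h.lintegral_missedMass h0 (fun i => by linarith [hhalf i]) s
  have hpair : ∀ᵐ q ∂(spaceTime.prod spaceTime),
      P (missedAt ξ ℓ s q.1.2 q.1.1 ∩ missedAt ξ ℓ s q.2.2 q.2.1) ≤ U ^ 2 * ENNReal.ofReal (F q) := by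
    filter_upwards [ae_spaceTime_prod_ne, Measure.quasiMeasurePreserving_fst.ae ae_spaceTime_mem_Icc,
      Measure.quasiMeasurePreserving_snd.ae ae_spaceTime_mem_Icc] with q hq h1 h2
    rw [← ofReal_measureReal, hU, ← ENNReal.ofReal_pow hu₀pos.le, ← ENNReal.ofReal_mul (by positivity)]
    refine ENNReal.ofReal_le_ofReal ?_
    refine (h.measureReal_missedAt_inter_le h0 hhalf s q.1.2 q.2.2 h1.1 h2.1).trans ?_
    exact mul_le_mul_of_nonneg_left (hF q.1 q.2 hq) (by positivity)
  have hsq := h.lintegral_missedMass_sq_le hpair hUt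
  have hZm := h.measurable_missedMass ℓ s
  have hset : MeasurableSet {ω | missedMass ξ ℓ s ω = 0} := hZm (measurableSet_singleton 0)
  have hint : ∫⁻ ω, (U ^ 2 * (if missedMass ξ ℓ s ω = 0 then 1 else 0) +
      2 * (U * missedMass ξ ℓ s ω)) ∂P ≤ ∫⁻ ω, (U ^ 2 + missedMass ξ ℓ s ω ^ 2) ∂P :=
    lintegral_mono fun ω => two_mul_add_sq_indicator_le U _
  have hind : ∫⁻ ω, (if missedMass ξ ℓ s ω = 0 then (1 : ENNReal) else 0) ∂P =
      P {ω | missedMass ξ ℓ s ω = 0} := by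
    rw [← lintegral_indicator_one hset]
    exact lintegral_congr fun ω => by simp [Set.indicator_apply]
  rw [lintegral_add_right _ ((hZm.const_mul U).const_mul 2), lintegral_const_mul' _ _ hUt,
    lintegral_const_mul' _ _ (by simp), lintegral_const_mul' _ _ (by finiteness), hmean, hind,
    lintegral_add_left measurable_const, lintegral_const, measure_univ, mul_one] at hint
  -- As `U` is the mean, the cross term is `2 U^2`; one `U^2` cancels and the other gives the `+ 1`.
  have h3 : U ^ 2 + U ^ 2 * (P {ω | missedMass ξ ℓ s ω = 0} + 1) ≤
      U ^ 2 + U ^ 2 * ∫⁻ q, ENNReal.ofReal (F q) ∂(spaceTime.prod spaceTime) := by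
    calc _ = U ^ 2 * P {ω | missedMass ξ ℓ s ω = 0} + 2 * (U * U) := by ring
      _ ≤ _ := hint.trans (by gcongr)
  exact (ENNReal.mul_le_mul_iff_right hU0 hUt).1 ((ENNReal.add_le_add_iff_left hUt).1 h3)

end IsArcSystem

/-! ### Compactness -/

lemma exists_mem_missedAt_of_missedMass_ne_zero {Ω : Type*} {ξ : ℕ → Ω → Path} {ℓ : ℕ → ℝ}
    {s : Finset ℕ} {ω : Ω} (h : missedMass ξ ℓ s ω ≠ 0) :
    ∃ z : ℝ × Circ, z.1 ∈ Set.Icc (0 : ℝ) 1 ∧ ω ∈ missedAt ξ ℓ s z.2 z.1 := by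
  by_contra! hcon
  exact h (measure_mono_null (t := {z | ¬ z.1 ∈ Set.Icc (0 : ℝ) 1})
    (fun z hz hz1 => hcon z hz1 hz) (ae_iff.1 ae_spaceTime_mem_Icc))

/-- If, for every `n`, some point is uncovered by the arcs with index in `[m, n)` at some time, then
at some time some point is uncovered by all the arcs with large index. -/
lemma exists_limit_uncovered {Ω : Type*} {ξ : ℕ → Ω → Path} {ℓ : ℕ → ℝ} {m : ℕ} {ω : Ω}
    (hreg : ∀ i, Regular (ξ i ω).2)
    (hcom : ∀ i i', i ≠ i' → ∀ j j', arrival (ξ i ω).2 (j + 1) ≠ arrival (ξ i' ω).2 (j' + 1))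
    (h : ∀ n, ∃ z : ℝ × Circ, z.1 ∈ Set.Icc (0 : ℝ) 1 ∧ ω ∈ missedAt ξ ℓ (Finset.Ico m n) z.2 z.1) :
    ∃ t ∈ Set.Icc (0 : ℝ) 1, ∃ x, ∃ M, ∀ i ≥ M, position t (ξ i ω) ∈ avoiding x (ℓ i) := by
  choose z hz1 hz2 using h
  have hcomp : IsCompact (Set.Icc (0 : ℝ) 1 ×ˢ (Set.univ : Set Circ)) :=
    isCompact_Icc.prod isCompact_univ
  obtain ⟨⟨t, x⟩, htx, φ, hφ, hlim⟩ := hcomp.tendsto_subseq fun n => ⟨hz1 n, Set.mem_univ (z n).2⟩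
  have ht : t ∈ Set.Icc (0 : ℝ) 1 := htx.1
  have hlt : Tendsto (fun n => (z (φ n)).1) atTop (nhds t) := (continuous_fst.tendsto _).comp hlim
  have hlx : Tendsto (fun n => (z (φ n)).2) atTop (nhds x) := (continuous_snd.tendsto _).comp hlim
  -- An arc with no update at `t` is at rest near `t`, and avoiding an open arc is a closed
  -- condition, so it survives the limit.
  have hkey : ∀ i ≥ m, (∀ j, 1 ≤ j → arrival (ξ i ω).2 j ≠ t) →
      position t (ξ i ω) ∈ avoiding x (ℓ i) := by
    intro i him hno
    have hev := (hreg i).eventually_updateCount_eq ht.1 hno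
    have hlt' : Tendsto (fun n => (z (φ n)).1) atTop (nhdsWithin t (Set.Ici 0)) :=
      tendsto_nhdsWithin_iff.2 ⟨hlt, Eventually.of_forall fun n => (hz1 (φ n)).1⟩
    have hnorm : Tendsto (fun n => ‖(z (φ n)).2 - position t (ξ i ω)‖) atTop
        (nhds ‖x - position t (ξ i ω)‖) := (hlx.sub_const _).norm
    refine ge_of_tendsto hnorm ?_
    filter_upwards [hlt'.eventually hev, eventually_gt_atTop i] with n hn hin
    have h1 := Set.mem_iInter₂.1 (hz2 (φ n)) i
      (Finset.mem_Ico.2 ⟨him, lt_of_lt_of_le hin hφ.le_apply⟩)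
    have h2 : position (z (φ n)).1 (ξ i ω) ∈ avoiding (z (φ n)).2 (ℓ i) := h1
    rw [position, hn] at h2
    exact h2
  refine ⟨t, ht, x, ?_⟩
  -- If an arc `i₀` updates at `t`, no other arc does, and starting beyond `i₀` removes it.
  by_cases hex : ∃ i₀ j₀, arrival (ξ i₀ ω).2 (j₀ + 1) = t
  · obtain ⟨i₀, j₀, h₀⟩ := hex
    refine ⟨max m (i₀ + 1), fun i hi => hkey i ((le_max_left _ _).trans hi) fun j hj hjt => ?_⟩
    obtain ⟨k, rfl⟩ := Nat.exists_eq_add_of_le' hj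
    have hne : i ≠ i₀ := by
      have := (le_max_right m (i₀ + 1)).trans hi
      omega
    exact hcom i i₀ hne k j₀ (hjt.trans h₀.symm)
  · refine ⟨m, fun i hi => hkey i hi fun j hj hjt => hex ?_⟩
    obtain ⟨k, rfl⟩ := Nat.exists_eq_add_of_le' hj
    exact ⟨i, k, hjt⟩

/-! ### Integrability of the correlation function -/

lemma lintegral_exp_neg_mul_abs_le {a : ℝ} (ha : 0 < a) :
    ∫⁻ v : ℝ, ENNReal.ofReal (Real.exp (-(a * |v|))) ≤ ENNReal.ofReal (2 / a) := by
  have hpdf : ∫⁻ v, exponentialPDF a v = 1 := lintegral_exponentialPDF_eq_one ha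
  have hpdf' : ∫⁻ v, exponentialPDF a (-v) = 1 := by
    rw [lintegral_neg_eq_self (exponentialPDF a), hpdf]
  have hm : Measurable (exponentialPDF a) := (measurable_exponentialPDFReal a).ennreal_ofReal
  have hle : ∀ v : ℝ, ENNReal.ofReal (Real.exp (-(a * |v|))) ≤
      ENNReal.ofReal (1 / a) * (exponentialPDF a v + exponentialPDF a (-v)) := by
    intro v
    have h1 : ∀ w : ℝ, 0 ≤ w → ENNReal.ofReal (Real.exp (-(a * w))) =
        ENNReal.ofReal (1 / a) * exponentialPDF a w := by
      intro w hw
      rw [exponentialPDF_of_nonneg hw, ← ENNReal.ofReal_mul (by positivity)]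
      congr 1
      field_simp
    rw [mul_add]
    rcases le_total 0 v with hv | hv
    · rw [abs_of_nonneg hv, h1 v hv]
      exact le_self_add
    · rw [abs_of_nonpos hv, h1 (-v) (by linarith)]
      exact le_add_self
  refine (lintegral_mono hle).trans (le_of_eq ?_)
  rw [lintegral_const_mul' _ _ ENNReal.ofReal_ne_top, lintegral_add_left hm, hpdf, hpdf',
    one_add_one_eq_two, ← ENNReal.ofReal_ofNat 2, ← ENNReal.ofReal_mul (by positivity)]
  congr 1
  ring

/-- On `[0, 1]` one has `e^{-τ} ≤ 1 - τ/2`, so the integrand is at most `e^{c + S} e^{-Sτ/2}`. The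
resulting `4/S` is the gain due to the motion. The case `S = 0` is separate because `4 / 0` would be
read as `0`. -/
lemma lintegral_exp_correlation_le {t S c : ℝ} (ht : t ∈ Set.Icc (0 : ℝ) 1) (hS : 0 ≤ S) :
    ∫⁻ v in Set.Icc (0 : ℝ) 1, ENNReal.ofReal (Real.exp (Real.exp (-|t - v|) * S + c)) ≤
      ENNReal.ofReal (Real.exp c * if S = 0 then 1 else Real.exp S * (4 / S)) := by
  split_ifs with h0
  · subst h0
    simp
  have hSpos : 0 < S := lt_of_le_of_ne hS (Ne.symm h0)
  have hle : ∀ v ∈ Set.Icc (0 : ℝ) 1, ENNReal.ofReal (Real.exp (Real.exp (-|t - v|) * S + c)) ≤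
      ENNReal.ofReal (Real.exp c * Real.exp S) *
        ENNReal.ofReal (Real.exp (-(S / 2 * |t - v|))) := by
    intro v hv
    rw [← ENNReal.ofReal_mul (by positivity), ← Real.exp_add, ← Real.exp_add]
    refine ENNReal.ofReal_le_ofReal (Real.exp_le_exp.2 ?_)
    have hτ : |t - v| ≤ 1 := abs_le.2 ⟨by linarith [ht.1, hv.2], by linarith [ht.2, hv.1]⟩
    have hτ0 := abs_nonneg (t - v)
    set τ := |t - v|
    have h1 : Real.exp (-τ) ≤ 1 - τ / 2 := by
      rw [Real.exp_neg]
      have h2 : 1 + τ ≤ Real.exp τ := by linarith [Real.add_one_le_exp τ]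
      refine (inv_anti₀ (by linarith) h2).trans ?_
      rw [inv_le_iff_one_le_mul₀ (by linarith)]
      nlinarith
    nlinarith
  calc _ ≤ ∫⁻ v in Set.Icc (0 : ℝ) 1, ENNReal.ofReal (Real.exp c * Real.exp S) *
        ENNReal.ofReal (Real.exp (-(S / 2 * |t - v|))) := setLIntegral_mono' measurableSet_Icc hle
    _ ≤ ∫⁻ v, ENNReal.ofReal (Real.exp c * Real.exp S) *
        ENNReal.ofReal (Real.exp (-(S / 2 * |t - v|))) := setLIntegral_le_lintegral _ _
    _ = ENNReal.ofReal (Real.exp c * Real.exp S) *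
        ∫⁻ v, ENNReal.ofReal (Real.exp (-(S / 2 * |t - v|))) :=
          lintegral_const_mul' _ _ ENNReal.ofReal_ne_top
    _ = ENNReal.ofReal (Real.exp c * Real.exp S) *
        ∫⁻ v : ℝ, ENNReal.ofReal (Real.exp (-(S / 2 * |v|))) := by
          rw [lintegral_sub_left_eq_self
            (fun v : ℝ => ENNReal.ofReal (Real.exp (-(S / 2 * |v|)))) t]
    _ ≤ ENNReal.ofReal (Real.exp c * Real.exp S) * ENNReal.ofReal (2 / (S / 2)) := by
          gcongr
          exact lintegral_exp_neg_mul_abs_le (half_pos hSpos)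
    _ = _ := by
          rw [← ENNReal.ofReal_mul (by positivity)]
          congr 1
          field_simp
          ring

/-- The number of arcs that may contain two given points at distance `s`. -/
def scale (M s : ℝ) : ℕ := ⌈M / s⌉₊

lemma measurable_scale_norm (M : ℝ) : Measurable fun x : Circ => scale M ‖x‖ :=
  Nat.measurable_ceil.comp (measurable_const.div measurable_norm)

/-- The set lies between the radii `M/(k+2)` and `M/(k+1)`, a width of order `1/k^2`. -/
lemma volume_scale_eq_le {M : ℝ} (hM : 0 < M) (k : ℕ) :
    volume.real {x : Circ | scale M ‖x‖ = k + 2} ≤ 4 * M / ((k + 2 : ℕ) : ℝ) ^ 2 := by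
  have hk1 : (0 : ℝ) < (k : ℝ) + 1 := by positivity
  have hsub : {x : Circ | scale M ‖x‖ = k + 2} ⊆
      Metric.closedBall 0 (M / (k + 1)) \ Metric.ball 0 (M / (k + 2)) := by
    intro x hx
    have hx' : ⌈M / ‖x‖⌉₊ = k + 2 := hx
    rw [Nat.ceil_eq_iff (by omega)] at hx'
    obtain ⟨h1, h2⟩ := hx'
    have hpos : 0 < ‖x‖ := by
      by_contra hcon
      have h0 : ‖x‖ = 0 := le_antisymm (not_lt.1 hcon) (norm_nonneg _)
      rw [h0, div_zero] at h1
      push_cast at h1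
      have : (0 : ℝ) ≤ ((k + 2 - 1 : ℕ) : ℝ) := Nat.cast_nonneg _
      linarith
    have h1' : ((k : ℝ) + 1) < M / ‖x‖ := by
      have : ((k + 2 - 1 : ℕ) : ℝ) = (k : ℝ) + 1 := by
        rw [show k + 2 - 1 = k + 1 by omega]
        push_cast
        ring
      linarith
    push_cast at h2
    rw [lt_div_iff₀ hpos] at h1'
    rw [div_le_iff₀ hpos] at h2
    constructor
    · rw [mem_closedBall_zero_iff, le_div_iff₀ hk1]
      linarith
    · rw [mem_ball_zero_iff, not_lt, div_le_iff₀ (by positivity)]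
      linarith
  have hvol : ∀ r : ℝ, 0 ≤ r → volume.real (Metric.closedBall (0 : Circ) r) = min 1 (2 * r) := by
    intro r hr
    rw [Measure.real, AddCircle.volume_closedBall, ENNReal.toReal_ofReal (by positivity)]
  have hball : volume.real (Metric.ball (0 : Circ) (M / (k + 2))) = min 1 (2 * (M / (k + 2))) := by
    rw [← hvol _ (by positivity), Measure.real, Measure.real,
      measure_congr AddCircle.closedBall_ae_eq_ball]
  have hbs : Metric.ball (0 : Circ) (M / (k + 2)) ⊆ Metric.closedBall 0 (M / (k + 1)) :=
    Metric.ball_subset_closedBall.trans (Metric.closedBall_subset_closedBall (by gcongr; norm_num))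
  refine (measureReal_mono hsub).trans ?_
  rw [measureReal_sdiff hbs measurableSet_ball, hvol _ (by positivity), hball]
  have hmono : 2 * (M / ((k : ℝ) + 2)) ≤ 2 * (M / (k + 1)) := by gcongr; norm_num
  -- Truncation at the total length `1` of the circle can only reduce the difference.
  have hmin : min 1 (2 * (M / ((k : ℝ) + 1))) - min 1 (2 * (M / (k + 2))) ≤
      2 * (M / (k + 1)) - 2 * (M / (k + 2)) := by
    rcases min_cases 1 (2 * (M / ((k : ℝ) + 1))) with ⟨h1, h1'⟩ | ⟨h1, h1'⟩ <;>
      rcases min_cases 1 (2 * (M / ((k : ℝ) + 2))) with ⟨h2, h2'⟩ | ⟨h2, h2'⟩ <;>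
      rw [h1, h2] <;> linarith
  refine hmin.trans ?_
  have hdiff : 2 * (M / ((k : ℝ) + 1)) - 2 * (M / (k + 2)) = 2 * M / ((k + 1) * (k + 2)) := by
    field_simp
    ring
  rw [hdiff, div_le_div_iff₀ (by positivity) (by positivity)]
  push_cast
  have hk0 : (0 : ℝ) ≤ k := Nat.cast_nonneg k
  have : 0 ≤ M * ((k + 2) * k) := by positivity
  nlinarith

/-- An upper bound for the correlation of two points of space-time being uncovered by the arcs with
index at least `m`. -/
def correlation (ℓ : ℕ → ℝ) (M : ℝ) (m : ℕ) (q : (ℝ × Circ) × (ℝ × Circ)) : ℝ :=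
  Real.exp (Real.exp (-|q.1.1 - q.2.1|) * ∑ i ∈ Finset.Ico m (scale M ‖q.1.2 - q.2.2‖), ℓ i +
    6 * ∑' i, ℓ (i + m) ^ 2)

lemma measurable_correlation (ℓ : ℕ → ℝ) (M : ℝ) (m : ℕ) : Measurable (correlation ℓ M m) := by
  have h1 : Measurable fun q : (ℝ × Circ) × (ℝ × Circ) =>
      ∑ i ∈ Finset.Ico m (scale M ‖q.1.2 - q.2.2‖), ℓ i :=
    (Measurable.of_discrete (f := fun k : ℕ => ∑ i ∈ Finset.Ico m k, ℓ i)).comp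
      ((measurable_scale_norm M).comp (measurable_fst.snd.sub measurable_snd.snd))
  have h2 : Measurable fun q : (ℝ × Circ) × (ℝ × Circ) => Real.exp (-|q.1.1 - q.2.1|) := by
    fun_prop
  exact ((h2.mul h1).add_const _).exp

lemma summable_sq_of_le {ℓ : ℕ → ℝ} {M : ℝ} (h0 : ∀ i, 0 ≤ ℓ i)
    (hup : ∀ n : ℕ, ℓ n ≤ M / ((n : ℝ) + 1)) : Summable fun i => ℓ i ^ 2 := by
  have h1 : Summable fun n : ℕ => M ^ 2 * (1 / ((n + 1 : ℕ) : ℝ) ^ 2) :=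
    ((summable_nat_add_iff 1).2 (Real.summable_one_div_nat_pow.2 one_lt_two)).mul_left _
  refine Summable.of_nonneg_of_le (fun i => sq_nonneg _) (fun i => ?_) h1
  calc ℓ i ^ 2 ≤ (M / ((i : ℝ) + 1)) ^ 2 := pow_le_pow_left₀ (h0 i) (hup i) 2
    _ = _ := by push_cast; rw [div_pow]; ring

/-- Only arcs longer than `s` contribute, and `ℓ_i ≤ M/(i+1)` forces their index below `M/s`. The
bound is uniform in `n`. -/
lemma sum_max_sub_le {ℓ : ℕ → ℝ} {M : ℝ} (h0 : ∀ i, 0 ≤ ℓ i)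
    (hup : ∀ n : ℕ, ℓ n ≤ M / ((n : ℝ) + 1)) {s : ℝ} (hs : 0 < s) (m n : ℕ) :
    ∑ i ∈ Finset.Ico m n, max (ℓ i - s) 0 ≤ ∑ i ∈ Finset.Ico m (scale M s), ℓ i := by
  have h1 : ∀ i, scale M s ≤ i → ℓ i ≤ s := by
    intro i hi
    have h2 : M / s ≤ i := (Nat.le_ceil _).trans (by exact_mod_cast hi)
    refine (hup i).trans ?_
    rw [div_le_iff₀ hs] at h2
    rw [div_le_iff₀ (by positivity)]
    linarith
  calc ∑ i ∈ Finset.Ico m n, max (ℓ i - s) 0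
      ≤ ∑ i ∈ Finset.Ico m n, if i < scale M s then ℓ i else 0 := by
        refine Finset.sum_le_sum fun i _ => ?_
        split_ifs with hi
        · exact max_le (by linarith) (h0 i)
        · exact max_le (by linarith [h1 i (not_lt.1 hi)]) le_rfl
    _ = ∑ i ∈ (Finset.Ico m n).filter (· < scale M s), ℓ i := (Finset.sum_filter _ _).symm
    _ ≤ _ := Finset.sum_le_sum_of_subset_of_nonneg (fun i hi => by
        simp only [Finset.mem_filter, Finset.mem_Ico] at hi ⊢
        exact ⟨hi.1.1, hi.2⟩) fun i _ _ => h0 i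

lemma exp_pair_le_correlation {ℓ : ℕ → ℝ} {M : ℝ} (h0 : ∀ i, 0 ≤ ℓ i)
    (hup : ∀ n : ℕ, ℓ n ≤ M / ((n : ℝ) + 1)) (m n : ℕ) (z z' : ℝ × Circ) (hz : z.2 ≠ z'.2) :
    Real.exp (Real.exp (-|z.1 - z'.1|) * ∑ i ∈ Finset.Ico m n, max (ℓ i - ‖z.2 - z'.2‖) 0 +
      6 * ∑ i ∈ Finset.Ico m n, ℓ i ^ 2) ≤ correlation ℓ M m (z, z') := by
  refine Real.exp_le_exp.2 (add_le_add (mul_le_mul_of_nonneg_left ?_ (Real.exp_pos _).le)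
    (mul_le_mul_of_nonneg_left ?_ (by norm_num)))
  · exact sum_max_sub_le h0 hup (norm_pos_iff.2 (sub_ne_zero.2 hz)) m n
  · rw [Finset.sum_Ico_eq_sum_range]
    simp_rw [add_comm m]
    exact ((summable_nat_add_iff m).2 (summable_sq_of_le h0 hup)).sum_le_tsum _
      fun i _ => sq_nonneg _

lemma correlation_le_zero {ℓ : ℕ → ℝ} {M : ℝ} (h0 : ∀ i, 0 ≤ ℓ i)
    (hup : ∀ n : ℕ, ℓ n ≤ M / ((n : ℝ) + 1)) (m : ℕ) (q : (ℝ × Circ) × (ℝ × Circ)) :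
    correlation ℓ M m q ≤ correlation ℓ M 0 q := by
  have hs := summable_sq_of_le h0 hup
  refine Real.exp_le_exp.2 (add_le_add (mul_le_mul_of_nonneg_left ?_ (Real.exp_pos _).le)
    (mul_le_mul_of_nonneg_left ?_ (by norm_num)))
  · exact Finset.sum_le_sum_of_subset_of_nonneg (Finset.Ico_subset_Ico_left (Nat.zero_le m))
      fun i _ _ => h0 i
  · simp only [add_zero]
    rw [← hs.sum_add_tsum_nat_add m]
    have : 0 ≤ ∑ i ∈ Finset.range m, ℓ i ^ 2 := Finset.sum_nonneg fun i _ => sq_nonneg _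
    linarith

/-- For fixed `q` the first sum is empty once `m` reaches the scale, and the second is the tail of a
series. -/
lemma tendsto_correlation (ℓ : ℕ → ℝ) (M : ℝ) (q : (ℝ × Circ) × (ℝ × Circ)) :
    Tendsto (fun m => correlation ℓ M m q) atTop (nhds 1) := by
  have h1 : Tendsto (fun m => ∑ i ∈ Finset.Ico m (scale M ‖q.1.2 - q.2.2‖), ℓ i) atTop (nhds 0) := by
    refine tendsto_const_nhds.congr' ?_
    filter_upwards [eventually_ge_atTop (scale M ‖q.1.2 - q.2.2‖)] with m hm
    rw [Finset.Ico_eq_empty_of_le hm, Finset.sum_empty]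
  have h2 := tendsto_sum_nat_add fun i => ℓ i ^ 2
  have h3 := ((h1.const_mul (Real.exp (-|q.1.1 - q.2.1|))).add (h2.const_mul 6)).rexp
  simpa [correlation] using h3

lemma partialLength_ge_log {ℓ : ℕ → ℝ} {M₀ : ℝ} (hM₀ : 0 < M₀)
    (hlow : ∀ n : ℕ, M₀ / ((n : ℝ) + 1) ≤ ℓ n) (k : ℕ) :
    M₀ * Real.log ((k + 2 : ℕ) : ℝ) ≤ partialLength ℓ (k + 2) := by
  have h1 := log_add_one_le_harmonic (k + 2)
  have h2 : Real.log ((k + 2 : ℕ) : ℝ) ≤ Real.log ((k + 2 + 1 : ℕ) : ℝ) :=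
    Real.log_le_log (by positivity) (by push_cast; linarith)
  have h3 : ((harmonic (k + 2) : ℚ) : ℝ) = ∑ i ∈ Finset.range (k + 2), 1 / ((i : ℝ) + 1) := by
    simp [harmonic]
  rw [h3] at h1
  calc M₀ * Real.log ((k + 2 : ℕ) : ℝ) ≤ M₀ * ∑ i ∈ Finset.range (k + 2), 1 / ((i : ℝ) + 1) := by
        gcongr
        exact h2.trans h1
    _ ≤ partialLength ℓ (k + 2) := by
        rw [partialLength, Finset.mul_sum]
        exact Finset.sum_le_sum fun i _ => by rw [mul_one_div]; exact hlow i

/-- With `L_k` the length of the first `k` arcs, time integration at scale `k` gives `O(e^{L_k} /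
L_k)`, and that scale has measure `O(1/k^2)`. Since `L_k ≥ M₀ log k`, the sum over `k` is dominated
by the assumed series. -/
lemma lintegral_correlation_zero_ne_top {ℓ : ℕ → ℝ} {M₀ M : ℝ} (hM₀ : 0 < M₀) (hM : 0 < M)
    (hlow : ∀ n : ℕ, M₀ / ((n : ℝ) + 1) ≤ ℓ n)
    (hsum : Summable (fun n : ℕ => Real.exp (partialLength ℓ (n + 2)) /
        (((n + 2 : ℕ) : ℝ) ^ 2 * Real.log ((n + 2 : ℕ) : ℝ)))) :
    ∫⁻ q, ENNReal.ofReal (correlation ℓ M 0 q) ∂(spaceTime.prod spaceTime) ≠ ⊤ := by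
  have h0 : ∀ i, 0 ≤ ℓ i := fun i => le_trans (by positivity) (hlow i)
  set c : ℝ := 6 * ∑' i, ℓ (i + 0) ^ 2 with hc
  set G : ℕ → ℝ := fun k => Real.exp c * if partialLength ℓ k = 0 then 1 else
    Real.exp (partialLength ℓ k) * (4 / partialLength ℓ k) with hG
  have hL0 : ∀ k, 0 ≤ partialLength ℓ k := fun k => Finset.sum_nonneg fun i _ => h0 i
  have hG0 : ∀ k, 0 ≤ G k := by
    intro k
    have := hL0 k
    simp only [hG]
    split_ifs <;> positivity
  set A : ENNReal := ∫⁻ x : Circ, ENNReal.ofReal (G (scale M ‖x‖)) with hA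
  have hmc : Measurable fun q => ENNReal.ofReal (correlation ℓ M 0 q) :=
    (measurable_correlation ℓ M 0).ennreal_ofReal
  have hle : ∫⁻ q, ENNReal.ofReal (correlation ℓ M 0 q) ∂(spaceTime.prod spaceTime) ≤ A := by
    rw [lintegral_prod _ hmc.aemeasurable]
    have hz : ∀ᵐ z ∂spaceTime,
        ∫⁻ z', ENNReal.ofReal (correlation ℓ M 0 (z, z')) ∂spaceTime ≤ A := by
      filter_upwards [ae_spaceTime_mem_Icc] with z hz
      have hmz : Measurable fun z' => ENNReal.ofReal (correlation ℓ M 0 (z, z')) :=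
        hmc.comp measurable_prodMk_left
      rw [lintegral_prod_symm _ hmz.aemeasurable, hA,
        ← lintegral_sub_left_eq_self (fun x : Circ => ENNReal.ofReal (G (scale M ‖x‖))) z.2]
      refine lintegral_mono fun x => ?_
      have := lintegral_exp_correlation_le (c := c) hz (hL0 (scale M ‖z.2 - x‖))
      simp only [correlation, ← Finset.range_eq_Ico]
      exact this
    refine (lintegral_mono_ae hz).trans ?_
    simp
  refine ne_top_of_le_ne_top ?_ hle
  have hA2 : A = ∑' k, ENNReal.ofReal (G k * volume.real {x : Circ | scale M ‖x‖ = k}) := by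
    rw [hA, ← lintegral_map (f := fun k : ℕ => ENNReal.ofReal (G k)) Measurable.of_discrete
      (measurable_scale_norm M), lintegral_countable']
    refine tsum_congr fun k => ?_
    rw [ENNReal.ofReal_mul (hG0 k), Measure.map_apply (measurable_scale_norm M)
      (measurableSet_singleton k), ofReal_measureReal]
    rfl
  rw [hA2]
  -- The two scales `0` and `1`, where the logarithm is not positive, do not affect summability.
  refine Summable.tsum_ofReal_ne_top ((summable_nat_add_iff 2).1 ?_)
  refine Summable.of_nonneg_of_le (fun k => mul_nonneg (hG0 _) measureReal_nonneg) (fun k => ?_)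
    (hsum.mul_left (Real.exp c * (4 / M₀) * (4 * M)))
  have hlog : 0 < Real.log ((k + 2 : ℕ) : ℝ) := Real.log_pos (by push_cast; linarith)
  have hL := partialLength_ge_log hM₀ hlow k
  have hLpos : 0 < partialLength ℓ (k + 2) := lt_of_lt_of_le (by positivity) hL
  have hGk : G (k + 2) ≤ Real.exp c * (Real.exp (partialLength ℓ (k + 2)) *
      (4 / (M₀ * Real.log ((k + 2 : ℕ) : ℝ)))) := by
    simp only [hG]
    rw [if_neg hLpos.ne']
    gcongr
  refine (mul_le_mul hGk (volume_scale_eq_le hM k) measureReal_nonneg (by positivity)).trans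
    (le_of_eq ?_)
  field_simp

lemma tendsto_lintegral_correlation {ℓ : ℕ → ℝ} {M₀ M : ℝ} (hM₀ : 0 < M₀) (hM : 0 < M)
    (hlow : ∀ n : ℕ, M₀ / ((n : ℝ) + 1) ≤ ℓ n) (hup : ∀ n : ℕ, ℓ n ≤ M / ((n : ℝ) + 1))
    (hsum : Summable (fun n : ℕ => Real.exp (partialLength ℓ (n + 2)) /
        (((n + 2 : ℕ) : ℝ) ^ 2 * Real.log ((n + 2 : ℕ) : ℝ)))) :
    Tendsto (fun m => ∫⁻ q, ENNReal.ofReal (correlation ℓ M m q) ∂(spaceTime.prod spaceTime)) atTop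
      (nhds 1) := by
  have h0 : ∀ i, 0 ≤ ℓ i := fun i => le_trans (by positivity) (hlow i)
  have h := tendsto_lintegral_of_dominated_convergence (μ := spaceTime.prod spaceTime)
    (F := fun m q => ENNReal.ofReal (correlation ℓ M m q)) (f := fun _ => 1)
    (fun q => ENNReal.ofReal (correlation ℓ M 0 q))
    (fun m => (measurable_correlation ℓ M m).ennreal_ofReal)
    (fun m => Eventually.of_forall fun q =>
      ENNReal.ofReal_le_ofReal (correlation_le_zero h0 hup m q))
    (lintegral_correlation_zero_ne_top hM₀ hM hlow hsum)
    (Eventually.of_forall fun q => by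
      simpa using ENNReal.tendsto_ofReal (tendsto_correlation ℓ M q))
  simpa using h

/-! ### Existence of exceptional times -/

/-- `Z m` is the event that the uncovered area of the arcs from `m` on vanishes at some finite
stage. The second moment bound gives `P (Z m) → 0`, so almost every `ω` avoids some `Z m`, and no
zero-one law is needed. -/
theorem ae_exists_uncoveredSet_nonempty {Ω : Type*} [MeasurableSpace Ω] {P : Measure Ω}
    [IsProbabilityMeasure P] {ℓ : ℕ → ℝ} (hhalf : ∀ i, ℓ i ≤ 1 / 2) (hΘ : IsThetaInv ℓ)
    {C : ℕ → ℕ → Ω → Circ} {Y : ℕ → ℕ → Ω → ℝ} (hmodel : IsPoissonInput P 0 ℓ C Y)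
    (hsum : Summable (fun n : ℕ => Real.exp (partialLength ℓ (n + 2)) /
        (((n + 2 : ℕ) : ℝ) ^ 2 * Real.log ((n + 2 : ℕ) : ℝ)))) :
    ∀ᵐ ω ∂P, ∃ t ∈ Set.Icc (0 : ℝ) 1, (uncoveredSet ℓ C Y t ω).Nonempty := by
  obtain ⟨M₀, M, hM₀, hMM, hbound⟩ := hΘ
  have hM : 0 < M := hM₀.trans_le hMM
  have hlow := fun n => (hbound n).1
  have hup := fun n => (hbound n).2
  have h0 : ∀ i, 0 ≤ ℓ i := fun i => le_trans (by positivity) (hlow i)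
  have h := hmodel.isArcSystem
  set ξ := inputPath C Y with hξ
  set Z : ℕ → Set Ω := fun m => ⋃ n, {ω | missedMass ξ ℓ (Finset.Ico m n) ω = 0} with hZ
  have hZle : ∀ m, P (Z m) + 1 ≤
      ∫⁻ q, ENNReal.ofReal (correlation ℓ M m q) ∂(spaceTime.prod spaceTime) := by
    intro m
    have hmono : Monotone fun n => {ω | missedMass ξ ℓ (Finset.Ico m n) ω = 0} := by
      intro n n' hn ω hω
      refine measure_mono_null (fun z hz => ?_) hω
      exact Set.biInter_subset_biInter_left (Finset.Ico_subset_Ico_right hn) hz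
    have hlim := (tendsto_measure_iUnion_atTop (μ := P) hmono).add_const 1
    exact le_of_tendsto' hlim fun n => h.measure_missedMass_eq_zero_add_one_le h0 hhalf
      (F := correlation ℓ M m) fun z z' hz => exp_pair_le_correlation h0 hup m n z z' hz
  have hnull : P (⋂ m, Z m) = 0 := by
    have h1 : P (⋂ m, Z m) + 1 ≤ 1 := ge_of_tendsto'
      (tendsto_lintegral_correlation hM₀ hM hlow hup hsum) fun m =>
        (add_le_add_left (measure_mono (Set.iInter_subset Z m)) 1).trans (hZle m)
    have h2 : P (⋂ m, Z m) + 1 ≤ 0 + 1 := by simpa using h1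
    exact le_antisymm ((ENNReal.add_le_add_iff_right ENNReal.one_ne_top).1 h2) bot_le
  have hae : ∀ᵐ ω ∂P, ω ∉ ⋂ m, Z m := by
    rw [ae_iff]
    simp only [not_not]
    exact hnull
  filter_upwards [h.ae_regular, h.ae_no_common_update, hae] with ω hreg hcom hω
  obtain ⟨m, hm⟩ := not_forall.1 (fun hcon => hω (Set.mem_iInter.2 hcon))
  have hne : ∀ n, missedMass ξ ℓ (Finset.Ico m n) ω ≠ 0 := fun n hn =>
    hm (Set.mem_iUnion.2 ⟨n, hn⟩)
  obtain ⟨t, ht, x, K, hx⟩ := exists_limit_uncovered hreg hcom fun n =>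
    exists_mem_missedAt_of_missedMass_ne_zero (hne n)
  exact ⟨t, ht, x, (mem_uncoveredSet_iff hreg ht.1).2 ⟨K, hx⟩⟩

end CircleCovering

end

/-! ### The dichotomy -/

theorem theorem1p6 {Ω : Type*} [MeasurableSpace Ω] (P : Measure Ω) [IsProbabilityMeasure P]
    (ℓ : ℕ → ℝ) (hanti : Antitone ℓ) (hhalf : ℓ 0 ≤ 1 / 2) (hΘ : CircleCovering.IsThetaInv ℓ)
    (C : ℕ → ℕ → Ω → CircleCovering.Circ) (Y : ℕ → ℕ → Ω → ℝ)
    (hmodel : CircleCovering.IsPoissonInput P 0 ℓ C Y) :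
    (liminf (fun n : ℕ => (((n : ℝ) * Real.log n * CircleCovering.u ℓ n : ℝ) : EReal)) atTop < ⊤ →
      ∀ᵐ ω ∂P, ¬ ∃ t ∈ Set.Icc (0 : ℝ) 1, (CircleCovering.uncoveredSet ℓ C Y t ω).Nonempty) ∧
    (Summable (fun n : ℕ => Real.exp (CircleCovering.partialLength ℓ (n + 2)) /
        (((n + 2 : ℕ) : ℝ) ^ 2 * Real.log ((n + 2 : ℕ) : ℝ))) →
      ∀ᵐ ω ∂P, ∃ t ∈ Set.Icc (0 : ℝ) 1, (CircleCovering.uncoveredSet ℓ C Y t ω).Nonempty) := by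
  have hle : ∀ i, ℓ i ≤ 1 / 2 := fun i => (hanti (Nat.zero_le i)).trans hhalf
  refine ⟨fun hlim => ?_, CircleCovering.ae_exists_uncoveredSet_nonempty hle hΘ hmodel⟩
  -- A real number above the liminf bounds `n log n u_n` for infinitely many `n`; in `EReal` the
  -- liminf carries no default value.
  obtain ⟨D, hD, -⟩ := EReal.lt_iff_exists_real_btwn.1 hlim
  refine CircleCovering.ae_forall_uncoveredSet_eq_empty hle hΘ hmodel (D := D) ?_
  refine (frequently_lt_of_liminf_lt ?_ hD).mono fun n hn => (EReal.coe_lt_coe_iff.1 hn).le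
  exact isCobounded_ge_of_top
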